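/- **Setting.** Let $T$ be a finite tree with root $r$, and $(f_i)_{i\ge1}$ a sequence of non-negative integers. In the game \textsc{Firefighter}, $r$ burns initially; at each turn $i\ge 1$ the player protects at most $f_i$ vertices that are neither burning nor already protected, and then the fire spreads to every unprotected neighbour of a burning vertex. Burning and protected vertices stay so for ever. The value of a play is the number of vertices that never burn, and $\beta_I$ is the largest value over all plays, $(f_i)$ being known in advance. A (deterministic) online algorithm $\mathbf{OA}$ knows $(T,r)$, but its move at turn $i$ depends only on $f_1,\dots,f_i$; its value is $\lambda_{\mathbf{OA}}$. The ratio $\lambda_{\mathbf{OA}}/\beta_I$ is read as $1$ if $\beta_I=0$. For $\gamma\in(0,1]$, $\mathbf{OA}$ is $\gamma$-competitive on a class of instances $(T,r,(f_i))$ if $\lambda_{\mathbf{OA}}/\beta_I\ge\gamma$ on all of them, and optimal if it is $\gamma$-competitive for the largest $\gamma$ for which a $\gamma$-competitive online algorithm exists. Put $$\alpha_{I,k}=\inf_{T}\ \max_{\mathbf{OA}}\ \min_{\sum_i f_i\le k}\ \frac{\lambda_{\mathbf{OA}}}{\beta_I},\qquad \alpha_I=\lim_{k\to\infty}\alpha_{I,k},\qquad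 \varphi=\frac{1+\sqrt5}2 ,$$ where $T$ ranges over the finite rooted trees and $\mathbf{OA}$ over the online algorithms. The weight $w_v$ of a vertex $v$ is the number of vertices of the subtree $T[v]$ formed by $v$ and its descendants; the level of a vertex is its distance from $r$; $\bar w_{v,j}$ is the maximum weight of a vertex of level $j$ in $T[v]$, and $0$ if there is none; $h$ is the maximum level. *Greedy algorithm.* At turn $i$ it protects a set of at most $f_i$ vertices of level $i$ without protected ancestors, of maximum total weight. *Two-firefighter algorithm.* The firefighters presented at a turn are handled one by one; let $C$ be the set of the vertices, at that moment, that are neither burning nor protected and have a burning neighbour. If $C=\emptyset$ the firefighter is not used. The first firefighter that is used, say at turn $t$: let $a,b\in C$ be two vertices of maximum weights, $w_a\ge w_b$ ($a=b$ if $|C|=1$); protect $a$ if $\frac{w_a+\bar w_{b,j}}{w_b+\bar w_{a,j}}\ge\frac1\varphi$ for all $t+1\le j\le h+1$, and $b$ otherwise. Every later firefighter is placed on a vertex of maximum weight in $C$. (In both algorithms ties are broken arbitrarily.) *The tree $W_{k,l,m}$* ($k\ge1$, $l\ge2$, $m\ge1$, $k\mid m-1$). The root $r$ has two children $x$ and $y$.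 The vertex $x$ has a single child, which has $l-2$ children, all of them leaves, so that $T[x]$ has $l$ vertices; below $y$ hang $k$ chains of $(m-1)/k$ vertices each, so that $T[y]$ has $m$ vertices. **Proposition.** For all $k\ge 2$, $\frac12\le\alpha_{I,k}\le\frac1\varphi$. More precisely: (i) $\alpha_I=\frac12$ (in particular the limit exists). The greedy algorithm is $\frac12$-competitive for \textsc{Firefighter} on finite trees, and no online algorithm is $\gamma$-competitive for any $\gamma>\frac12$; so greedy is optimal. (ii) $\alpha_{I,2}=\frac1\varphi$. The two-firefighter algorithm is $\frac1\varphi$-competitive on the instances with at most two firefighters in total, and no online algorithm is $\gamma$-competitive on these instances for any $\gamma>\frac1\varphi$; so it is optimal there. (iii) $\alpha_{I,4}<\frac1\varphi$. This is witnessed by the tree $T=W_{4,901,1001}$: on it, $\max_{\mathbf{OA}}\min_{\sum_i f_i\le 4}\lambda_{\mathbf{OA}}/\beta_I<\frac1\varphi$. -/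

import Mathlib

open Filter Topology

namespace Firefighter

noncomputable section

/-- A finite tree with a distinguished vertex `root`, where the fire breaks out. -/
structure RootedTree where
  V : Type
  [fintype : Fintype V]
  graph : SimpleGraph V
  isTree : graph.IsTree
  root : V

attribute [instance] RootedTree.fintype

/-! ### The game

Turns are numbered from `0`: index `t` of a firefighter sequence `f`, or of a play `p`, is the
`(t+1)`-st turn of the game. -/

section Game

variable (T : RootedTree)

/-- The vertices protected during the first `n` turns of the play `p`. -/
def protectedBy (p : ℕ → Finset T.V) (n : ℕ) : Set T.V :=
  {v | ∃ t < n, v ∈ p t}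

/-- The vertices that are burning after `n` turns of the play `p`: in each turn the protections
are placed first, then the fire spreads to all unprotected neighbours of burning vertices. -/
def burnt (p : ℕ → Finset T.V) : ℕ → Set T.V
  | 0 => {T.root}
  | n + 1 => burnt p n ∪
      {v | (∃ u ∈ burnt p n, T.graph.Adj u v) ∧ v ∉ protectedBy T p (n + 1)}

/-- `p` is a legal play for the firefighter sequence `f`: in each turn at most as many vertices
are protected as there are firefighters, none of them burning or already protected. -/
def Legal (f : ℕ → ℕ) (p : ℕ → Finset T.V) : Prop :=
  ∀ t, (p t).card ≤ f t ∧ ∀ v ∈ p t, v ∉ burnt T p t ∧ v ∉ protectedBy T p t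

/-- The number of vertices that never burn. -/
def saved (p : ℕ → Finset T.V) : ℕ :=
  {v : T.V | ∀ n, v ∉ burnt T p n}.ncard

/-- The offline optimal value `β_I`. -/
def offlineOpt (f : ℕ → ℕ) : ℕ :=
  sSup {s : ℕ | ∃ p, Legal T f p ∧ saved T p = s}

/-- A (deterministic) online algorithm on the tree `T`: it answers every firefighter sequence by a
legal play, and its move in a turn depends only on what has been revealed up to that turn. -/
structure Strategy where
  play : (ℕ → ℕ) → ℕ → Finset T.V
  legal : ∀ f, Legal T f (play f)
  causal : ∀ f g t, (∀ s ≤ t, f s = g s) → play f t = play g t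

/-- The performance `λ / β_I` of an online algorithm on a firefighter sequence; it is `1` by
convention when no vertex can be saved. -/
def ratio (A : Strategy T) (f : ℕ → ℕ) : ℝ :=
  if offlineOpt T f = 0 then 1 else (saved T (A.play f) : ℝ) / (offlineOpt T f : ℝ)

end Game

/-- The firefighter sequences with at most `k` firefighters in total. -/
def atMost (k : ℕ) : Set (ℕ → ℕ) :=
  {f | ∀ n, ∑ t ∈ Finset.range n, f t ≤ k}

/-- The best performance that an online algorithm can guarantee on the tree `T` against all
sequences of at most `k` firefighters. -/
def treeValue (k : ℕ) (T : RootedTree) : ℝ :=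
  ⨆ A : Strategy T, ⨅ f : atMost k, ratio T A f

/-- The optimal competitive ratio `α_{I,k}` on finite trees with at most `k` firefighters. -/
def alpha (k : ℕ) : ℝ :=
  ⨅ T : RootedTree, treeValue k T

/-- An online algorithm for finite trees; tree and root are known from the start. -/
abbrev OnlineAlgorithm := ∀ T : RootedTree, Strategy T

/-- `A` is `γ`-competitive on the instances whose firefighter sequence lies in `F`. -/
def Competitive (A : OnlineAlgorithm) (F : Set (ℕ → ℕ)) (γ : ℝ) : Prop :=
  0 < γ ∧ γ ≤ 1 ∧ ∀ T, ∀ f ∈ F, γ ≤ ratio T (A T) f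

/-- `A` guarantees the competitive ratio `γ` on the instances in `F`, and this is the best possible
competitive ratio on these instances. -/
def OptimalWithRatio (A : OnlineAlgorithm) (F : Set (ℕ → ℕ)) (γ : ℝ) : Prop :=
  Competitive A F γ ∧ ∀ (B : OnlineAlgorithm) (γ' : ℝ), Competitive B F γ' → γ' ≤ γ

/-! ### The rooted structure of a tree -/

section Rooted

variable (T : RootedTree)

/-- The level of a vertex: its distance from the root. -/
def level (v : T.V) : ℕ := T.graph.dist T.root v

/-- `u` is `v` or an ancestor of `v`: it lies on the path from the root to `v`. -/
def AncestorOrEq (u v : T.V) : Prop :=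
  level T u + T.graph.dist u v = level T v

/-- The weight of `v`: the number of vertices of the subtree consisting of `v` and its
descendants. -/
def weight (v : T.V) : ℕ := {u | AncestorOrEq T v u}.ncard

/-- The height of the tree. -/
def height : ℕ := Finset.univ.sup (level T)

open Classical in
/-- The maximum weight of a vertex of level `j` in the subtree of `v` (`0` if there is none). -/
def maxWeightBelow (v : T.V) (j : ℕ) : ℕ :=
  (Finset.univ.filter fun u => AncestorOrEq T v u ∧ level T u = j).sup (weight T)

end Rooted

/-! ### The greedy algorithm -/

section Greedy

variable (T : RootedTree)

/-- `X` is an admissible set of new protections for turn `t` (the `(t+1)`-st turn) after the play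
`p`, given `n` firefighters: at most `n` vertices of level `t + 1` without protected ancestors. -/
def GreedyFeasible (p : ℕ → Finset T.V) (t n : ℕ) (X : Finset T.V) : Prop :=
  X.card ≤ n ∧ ∀ v ∈ X, level T v = t + 1 ∧
    ∀ u, AncestorOrEq T u v → u ≠ v → u ∉ protectedBy T p t

/-- A greedy strategy maximises in each turn the total weight of the newly protected vertices. -/
def IsGreedyOn (A : Strategy T) : Prop :=
  ∀ f t, GreedyFeasible T (A.play f) t (f t) (A.play f t) ∧
    ∀ X, GreedyFeasible T (A.play f) t (f t) X →
      ∑ v ∈ X, weight T v ≤ ∑ v ∈ A.play f t, weight T v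

end Greedy

/-- `A` is a greedy algorithm (ties are broken arbitrarily). -/
def IsGreedy (A : OnlineAlgorithm) : Prop := ∀ T, IsGreedyOn T (A T)

/-! ### The algorithm for two firefighters

Contracting the burning vertices to a new root and deleting the subtrees of the protected vertices
gives the updated tree on which the algorithm works. -/

section TwoFirefighters

variable (T : RootedTree)

/-- The children of the root in the updated tree, when `B` is the set of burning vertices and `Q`
the set of protected vertices. -/
def children (B Q : Set T.V) : Set T.V :=
  {v | v ∉ B ∧ v ∉ Q ∧ ∃ u ∈ B, T.graph.Adj u v}

/-- `a`, `b` are two elements of `C` of maximum weights, `a` being the heavier; `a = b` exactly if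
`C` has only one element. -/
def IsTopPair (C : Set T.V) (a b : T.V) : Prop :=
  a ∈ C ∧ b ∈ C ∧ (∀ u ∈ C, weight T u ≤ weight T a) ∧
    (∀ u ∈ C, u ≠ a → weight T u ≤ weight T b) ∧ (a = b → C = {a})

/-- The test deciding whether the first firefighter, presented in turn `t`, is placed on `a`.
Level `i` of the updated tree is level `t + i` of `T`, and the height of the updated tree is
`height T - t`; so `i` ranging over `2 ≤ i ≤ 1 + (height T - t)` means that `j = t + i` ranges over
`t + 2 ≤ j ≤ height T + 1`. -/
def FirstTest (t : ℕ) (a b : T.V) : Prop :=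
  ∀ j, t + 2 ≤ j → j ≤ height T + 1 →
    1 / Real.goldenRatio ≤
      ((weight T a : ℝ) + maxWeightBelow T b j) / ((weight T b : ℝ) + maxWeightBelow T a j)

/-- The algorithm may place a firefighter on `v` in turn `t` if `B` is burning and `Q` is protected;
it is the first firefighter if `Q` is empty. -/
def Choice (t : ℕ) (B Q : Set T.V) (v : T.V) : Prop :=
  (Q = ∅ → ∃ a b, IsTopPair T (children T B Q) a b ∧
    (FirstTest T t a b → v = a) ∧ (¬ FirstTest T t a b → v = b)) ∧
  (Q ≠ ∅ → v ∈ children T B Q ∧ ∀ u ∈ children T B Q, weight T u ≤ weight T v)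

/-- `Serve T t B Q n Q'`: handling `n` firefighters one by one in turn `t`, while `B` is burning,
the algorithm can enlarge the set of protected vertices from `Q` to `Q'`. -/
inductive Serve (t : ℕ) (B : Set T.V) : Set T.V → ℕ → Set T.V → Prop
  | done (Q : Set T.V) : Serve t B Q 0 Q
  | skip (Q Q' : Set T.V) (n : ℕ) : children T B Q = ∅ → Serve t B Q n Q' →
      Serve t B Q (n + 1) Q'
  | place (Q Q' : Set T.V) (n : ℕ) (v : T.V) : (children T B Q).Nonempty → Choice T t B Q v →
      Serve t B (insert v Q) n Q' → Serve t B Q (n + 1) Q'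

/-- The strategy follows the two-firefighter algorithm on `T`. -/
def IsTwoFirefighterOn (A : Strategy T) : Prop :=
  ∀ f t, Serve T t (burnt T (A.play f) t) (protectedBy T (A.play f) t) (f t)
    (protectedBy T (A.play f) (t + 1))

end TwoFirefighters

/-- `A` follows the two-firefighter algorithm (ties are broken arbitrarily). -/
def IsTwoFirefighterAlgorithm (A : OnlineAlgorithm) : Prop := ∀ T, IsTwoFirefighterOn T (A T)

/-! ### The trees `W_{k,l,m}` -/

/-- The vertices of `W_{k,l,m}`, for `1 ≤ k`, `2 ≤ l`, `1 ≤ m` and `k ∣ m - 1`: a root `r`; a branch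
with `l` vertices, consisting of `x`, its only child `center` and the `l - 2` leaves below `center`;
a branch with `m` vertices, consisting of `y` and `k` chains of equal length below `y`. -/
inductive WVertex (k l m : ℕ) : Type
  | r | x | center | leaf (i : Fin (l - 2)) | y | chain (i : Fin k) (j : Fin ((m - 1) / k))
  deriving DecidableEq, Fintype

/-- The parent of a vertex (and `r` for the root). -/
def WVertex.parent {k l m : ℕ} : WVertex k l m → WVertex k l m
  | r => r
  | x => r
  | center => x
  | leaf _ => center
  | y => r
  | chain _ ⟨0, _⟩ => y
  | chain i ⟨j + 1, h⟩ => chain i ⟨j, by omega⟩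

/-- The depth of a vertex. -/
def WVertex.depth {k l m : ℕ} : WVertex k l m → ℕ
  | r => 0
  | x => 1
  | center => 2
  | leaf _ => 3
  | y => 1
  | chain _ j => j + 2

theorem WVertex.depth_parent {k l m : ℕ} (v : WVertex k l m) (hv : v ≠ .r) :
    v.parent.depth < v.depth := by
  match v with
  | r => exact absurd rfl hv
  | x => simp [parent, depth]
  | center => simp [parent, depth]
  | leaf _ => simp [parent, depth]
  | y => simp [parent, depth]
  | chain _ ⟨0, _⟩ => simp [parent, depth]
  | chain i ⟨j + 1, h⟩ => simp [parent, depth]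

/-- Each vertex is joined to its parent. -/
def WGraph (k l m : ℕ) : SimpleGraph (WVertex k l m) :=
  SimpleGraph.fromRel fun u v => u.parent = v

theorem WGraph_isTree (k l m : ℕ) : (WGraph k l m).IsTree := by
  have hne : ∀ v : WVertex k l m, v ≠ .r → v ≠ v.parent := by
    intro v hv h
    have := WVertex.depth_parent v hv
    rw [← h] at this
    exact lt_irrefl _ this
  have hreach : ∀ (n : ℕ) (v : WVertex k l m), v.depth = n → (WGraph k l m).Reachable v .r := by
    intro n
    induction n using Nat.strong_induction_on with
    | _ n ih =>
      intro v hn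
      by_cases hv : v = .r
      · rw [hv]
      · have hadj : (WGraph k l m).Adj v v.parent := by
          simp only [WGraph, SimpleGraph.fromRel_adj]
          exact ⟨hne v hv, Or.inl trivial⟩
        exact hadj.reachable.trans
          (ih _ (hn ▸ WVertex.depth_parent v hv) v.parent rfl)
  have hconn : (WGraph k l m).Connected :=
    { preconnected := fun u v => (hreach _ u rfl).trans (hreach _ v rfl).symm
      nonempty := ⟨.r⟩ }
  rw [SimpleGraph.isTree_iff_connected_and_card]
  refine ⟨hconn, le_antisymm ?_ hconn.card_vert_le_card_edgeSet_add_one⟩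
  have hsub : (WGraph k l m).edgeSet ⊆
      (fun v : WVertex k l m => s(v, v.parent)) '' {v | v ≠ .r} := by
    intro e
    induction e using Sym2.ind with
    | _ u v =>
      intro he
      rw [SimpleGraph.mem_edgeSet, WGraph, SimpleGraph.fromRel_adj] at he
      obtain ⟨huv, h | h⟩ := he
      · refine ⟨u, ?_, by simp [h]⟩
        rintro rfl
        exact huv h
      · refine ⟨v, ?_, by simp [h, Sym2.eq_swap]⟩
        rintro rfl
        exact huv h.symm
  have h1 : (WGraph k l m).edgeSet.ncard ≤ ({v : WVertex k l m | v ≠ .r}).ncard :=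
    (Set.ncard_le_ncard hsub (Set.toFinite _)).trans (Set.ncard_image_le (Set.toFinite _))
  have h2 : ({v : WVertex k l m | v ≠ .r}).ncard < Nat.card (WVertex k l m) := by
    rw [← Set.ncard_univ]
    exact Set.ncard_lt_ncard ⟨Set.subset_univ _, fun h => h (Set.mem_univ WVertex.r) rfl⟩
      (Set.toFinite _)
  have h3 : Nat.card (WGraph k l m).edgeSet = (WGraph k l m).edgeSet.ncard := rfl
  omega

/-- The rooted tree `W_{k,l,m}`. -/
def W (k l m : ℕ) : RootedTree where
  V := WVertex k l m
  graph := WGraph k l m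
  isTree := WGraph_isTree k l m
  root := .r

end

end Firefighter

/-!
Call the *cover* of a play at level `j` the set of the ancestors of level `j` of the vertices it
protects before the fire has reached level `j`. It is no larger than the number of firefighters of
the corresponding turn, and the subtrees of the covers contain all the saved vertices.

*Greedy.* The vertices of the optimal cover of a level that greedy does not save could have been
chosen by greedy, so they weigh at most as much as the vertices it chose. Hence the optimal play
saves at most as many vertices outside the set saved by greedy as greedy saves in all.

*Two firefighters.* The only delicate case is that of two firefighters in different turns. The
optimal play then saves at most the weight of some `u` of the first level concerned, plus the
maximum weight outside `T[u]` at the later level. If the first placement is on `c ≠ u`, the latter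
may lie in `T[c]`, out of reach of the algorithm; the loss is bounded by `φ`, through the test if
it succeeds, and through its failure and `φ ^ 2 = φ + 1` if it does not.

*Upper bounds.* On `W k l m` one firefighter comes first, and by causality the first move is the
same whatever follows. If it is spent in `T[x]`, the adversary sends at most one more firefighter,
in the next turn, which the optimal play uses on the child of `x` after having protected `y`. If it
is spent in `T[y]`, the adversary waits one turn and sends `b` firefighters, which the optimal play
uses on the chains after having protected `x`. The sizes `l = m = k ^ 2 + 1` push the value down to
`1 / 2`, and consecutive Fibonacci numbers push it down to `1 / φ` with two firefighters.
-/

namespace Firefighter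

noncomputable section

section Dist

variable {V : Type*} {G : SimpleGraph V} {r u v w : V}

theorem exists_adj_of_dist_eq_add_one {n : ℕ} (h : G.dist r v = n + 1) :
    ∃ w, G.Adj w v ∧ G.dist r w = n := by
  have hreach : G.Reachable r v := SimpleGraph.Reachable.of_dist_ne_zero (by omega)
  obtain ⟨p, hp⟩ := hreach.exists_walk_length_eq_dist
  have hadj : G.Adj p.penultimate v :=
    p.adj_penultimate (by rw [← SimpleGraph.Walk.length_eq_zero_iff]; omega)
  obtain ⟨q, hq⟩ := p.dropLast.reachable.exists_walk_length_eq_dist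
  have hle : G.dist r p.penultimate ≤ p.dropLast.length := SimpleGraph.dist_le _
  have hge : G.dist r v ≤ (q.concat hadj).length := SimpleGraph.dist_le _
  rw [SimpleGraph.Walk.length_dropLast] at hle
  rw [SimpleGraph.Walk.length_concat] at hge
  exact ⟨p.penultimate, hadj, by omega⟩

theorem eq_of_adj_of_dist_eq_add_one (hG : G.IsAcyclic) (hu : G.Adj u v) (hw : G.Adj w v)
    (hdu : G.dist r v = G.dist r u + 1) (hdw : G.dist r v = G.dist r w + 1) : u = w := by
  have hpath : ∀ x, G.Adj x v → G.dist r v = G.dist r x + 1 →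
      ∃ p : G.Path r v, p.1.penultimate = x := by
    intro x hx hd
    have hreach : G.Reachable r v := SimpleGraph.Reachable.of_dist_ne_zero (by omega)
    obtain ⟨p, hp⟩ := (hreach.trans hx.symm.reachable).exists_walk_length_eq_dist
    refine ⟨⟨p.concat hx, SimpleGraph.Walk.isPath_of_length_eq_dist _ ?_⟩, by simp⟩
    rw [SimpleGraph.Walk.length_concat, hp, hd]
  obtain ⟨p, rfl⟩ := hpath u hu hdu
  obtain ⟨q, rfl⟩ := hpath w hw hdw
  rw [(hG.subsingleton_path r v).elim p q]

end Dist

section Ancestors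

variable {T : RootedTree} {u v w : T.V} {j : ℕ}

theorem level_root : level T T.root = 0 := SimpleGraph.dist_self

theorem level_eq_zero_iff : level T v = 0 ↔ v = T.root :=
  T.isTree.connected.dist_eq_zero_iff.trans eq_comm

theorem level_le_height (v : T.V) : level T v ≤ height T :=
  Finset.le_sup (f := level T) (Finset.mem_univ v)

theorem level_eq_of_adj (h : T.graph.Adj u v) :
    level T v = level T u + 1 ∨ level T u = level T v + 1 :=
  (T.isTree.dist_eq_dist_add_one_of_adj T.root h).symm

theorem exists_parent {n : ℕ} (h : level T v = n + 1) : ∃ w, T.graph.Adj w v ∧ level T w = n :=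
  exists_adj_of_dist_eq_add_one h

theorem level_le_add_dist (u v : T.V) : level T v ≤ level T u + T.graph.dist u v :=
  T.isTree.connected.dist_triangle

namespace AncestorOrEq

theorem refl (v : T.V) : AncestorOrEq T v v := by simp [AncestorOrEq]

theorem level_le (h : AncestorOrEq T u v) : level T u ≤ level T v := by
  rw [AncestorOrEq] at h
  omega

theorem trans (huv : AncestorOrEq T u v) (hvw : AncestorOrEq T v w) : AncestorOrEq T u w := by
  have htri := T.isTree.connected.dist_triangle (u := u) (v := v) (w := w)
  have hle := level_le_add_dist u w
  rw [AncestorOrEq] at *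
  omega

theorem eq_of_level_le (h : AncestorOrEq T u v) (hl : level T v ≤ level T u) : u = v := by
  rw [AncestorOrEq] at h
  exact T.isTree.connected.dist_eq_zero_iff.1 (by omega)

theorem level_lt (h : AncestorOrEq T u v) (hne : u ≠ v) : level T u < level T v :=
  lt_of_not_ge fun hl => hne (h.eq_of_level_le hl)

theorem of_adj (h : T.graph.Adj u v) (hl : level T v = level T u + 1) : AncestorOrEq T u v := by
  rw [AncestorOrEq, SimpleGraph.dist_eq_one_iff_adj.2 h, hl]

end AncestorOrEq

theorem ancestorOrEq_iff_of_adj (hwv : T.graph.Adj w v) (hl : level T v = level T w + 1) :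
    AncestorOrEq T u v ↔ u = v ∨ AncestorOrEq T u w := by
  constructor
  · intro h
    by_cases hne : u = v
    · exact .inl hne
    have hlt := h.level_lt hne
    have hdist : level T u + T.graph.dist u v = level T v := h
    obtain ⟨n, hn⟩ : ∃ n, T.graph.dist u v = n + 1 := ⟨T.graph.dist u v - 1, by omega⟩
    obtain ⟨x, hxv, hux⟩ := exists_adj_of_dist_eq_add_one hn
    have hle := level_le_add_dist u x
    have hlx : level T v = level T x + 1 := by
      rcases level_eq_of_adj hxv with h | h <;> omega
    obtain rfl := eq_of_adj_of_dist_eq_add_one T.isTree.isAcyclic hxv hwv hlx hl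
    right
    rw [AncestorOrEq]
    omega
  · rintro (rfl | h)
    · exact .refl u
    · exact h.trans (.of_adj hwv hl)

theorem AncestorOrEq.of_level_le (hu : AncestorOrEq T u v) (hw : AncestorOrEq T w v)
    (hl : level T u ≤ level T w) : AncestorOrEq T u w := by
  induction hn : level T v generalizing v with
  | zero => rwa [hw.eq_of_level_le (by omega)]
  | succ n ih =>
    obtain ⟨x, hxv, hx⟩ := exists_parent hn
    have hiff := fun y => ancestorOrEq_iff_of_adj (u := y) hxv (by omega)
    rcases (hiff w).1 hw with rfl | hwx
    · exact hu
    rcases (hiff u).1 hu with rfl | hux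
    · exact absurd hwx.level_le (by omega)
    · exact ih hux hwx hx

theorem AncestorOrEq.eq_of_level_eq (hu : AncestorOrEq T u v) (hw : AncestorOrEq T w v)
    (hl : level T u = level T w) : u = w :=
  (hu.of_level_le hw hl.le).eq_of_level_le hl.ge

theorem exists_ancestorOrEq_level_eq (h : j ≤ level T v) :
    ∃ u, AncestorOrEq T u v ∧ level T u = j := by
  induction hn : level T v generalizing v with
  | zero => exact ⟨v, .refl v, by omega⟩
  | succ n ih =>
    rcases h.eq_or_lt with rfl | hlt
    · exact ⟨v, .refl v, rfl⟩
    obtain ⟨w, hwv, hw⟩ := exists_parent hn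
    obtain ⟨u, huw, hu⟩ := ih (v := w) (by omega) hw
    exact ⟨u, huw.trans (.of_adj hwv (by omega)), hu⟩

/-- The ancestor of `v` of level `j`, or `v` itself if `v` has a smaller level. -/
def ancestorAt (T : RootedTree) (j : ℕ) (v : T.V) : T.V :=
  (exists_ancestorOrEq_level_eq (min_le_right j (level T v))).choose

theorem ancestorAt_ancestorOrEq (j : ℕ) (v : T.V) : AncestorOrEq T (ancestorAt T j v) v :=
  (exists_ancestorOrEq_level_eq (min_le_right j (level T v))).choose_spec.1

theorem level_ancestorAt (h : j ≤ level T v) : level T (ancestorAt T j v) = j :=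
  (exists_ancestorOrEq_level_eq (min_le_right j (level T v))).choose_spec.2.trans
    (min_eq_left h)

end Ancestors

section Weights

variable {T : RootedTree} {u v : T.V} {i j n : ℕ}

/-- The vertex set of the subtree `T[v]`; its cardinality is the weight of `v`. -/
def below (T : RootedTree) (v : T.V) : Set T.V := {u | AncestorOrEq T v u}

theorem below_subset (h : AncestorOrEq T u v) : below T v ⊆ below T u :=
  fun _ hw => h.trans hw

theorem disjoint_below (huv : ¬ AncestorOrEq T u v) (hvu : ¬ AncestorOrEq T v u) :
    Disjoint (below T u) (below T v) := by
  refine Set.disjoint_left.2 fun w hu hv => ?_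
  rcases le_total (level T u) (level T v) with hl | hl
  · exact huv (AncestorOrEq.of_level_le hu hv hl)
  · exact hvu (AncestorOrEq.of_level_le hv hu hl)

theorem weight_pos (v : T.V) : 0 < weight T v :=
  (Set.ncard_pos (Set.toFinite _)).2 ⟨v, .refl v⟩

theorem weight_le_weight (h : AncestorOrEq T u v) : weight T v ≤ weight T u :=
  Set.ncard_le_ncard (below_subset h) (Set.toFinite _)

theorem weight_le_maxWeightBelow (h : AncestorOrEq T u v) :
    weight T v ≤ maxWeightBelow T u (level T v) := by
  classical
  exact Finset.le_sup (f := weight T) (by simp [h])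

theorem maxWeightBelow_le
    (h : ∀ v, AncestorOrEq T u v → level T v = j → weight T v ≤ n) : maxWeightBelow T u j ≤ n := by
  classical
  refine Finset.sup_le fun v hv => ?_
  rw [Finset.mem_filter] at hv
  exact h v hv.2.1 hv.2.2

theorem maxWeightBelow_anti (hi : level T u ≤ i) (hij : i ≤ j) :
    maxWeightBelow T u j ≤ maxWeightBelow T u i := by
  refine maxWeightBelow_le fun v huv hv => ?_
  obtain ⟨w, hwv, rfl⟩ := exists_ancestorOrEq_level_eq (hv ▸ hij : i ≤ level T v)
  exact (weight_le_weight hwv).trans (weight_le_maxWeightBelow (huv.of_level_le hwv hi))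

open Classical in
/-- The maximum weight of a vertex of level `j` outside the subtree of `u` (`0` if there is none):
what a firefighter on level `j` can add to a play that already protects `u`. -/
def maxWeightOff (T : RootedTree) (u : T.V) (j : ℕ) : ℕ :=
  (Finset.univ.filter fun v => ¬ AncestorOrEq T u v ∧ level T v = j).sup (weight T)

theorem weight_le_maxWeightOff (h : ¬ AncestorOrEq T u v) :
    weight T v ≤ maxWeightOff T u (level T v) := by
  classical
  exact Finset.le_sup (f := weight T) (by simp [h])

theorem maxWeightOff_le
    (h : ∀ v, ¬ AncestorOrEq T u v → level T v = j → weight T v ≤ n) : maxWeightOff T u j ≤ n := by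
  classical
  refine Finset.sup_le fun v hv => ?_
  rw [Finset.mem_filter] at hv
  exact h v hv.2.1 hv.2.2

end Weights

section Cover

variable {T : RootedTree}

theorem ncard_le_sum_weight {ι : Type*} {S : Set T.V} {F : Finset ι} {A : ι → Finset T.V}
    (h : ∀ v ∈ S, ∃ i ∈ F, ∃ u ∈ A i, AncestorOrEq T u v) :
    S.ncard ≤ ∑ i ∈ F, ∑ u ∈ A i, weight T u := by
  have hsub : S ⊆ ⋃ i ∈ F, ⋃ u ∈ A i, below T u := by
    intro v hv
    simpa only [Set.mem_iUnion, exists_prop, below, Set.mem_ofPred_eq] using h v hv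
  calc S.ncard ≤ (⋃ i ∈ F, ⋃ u ∈ A i, below T u).ncard := Set.ncard_le_ncard hsub (Set.toFinite _)
    _ ≤ ∑ i ∈ F, (⋃ u ∈ A i, below T u).ncard := Finset.set_ncard_biUnion_le _ _
    _ ≤ ∑ i ∈ F, ∑ u ∈ A i, weight T u :=
      Finset.sum_le_sum fun i _ => Finset.set_ncard_biUnion_le _ _

theorem sum_weight_le_ncard {S : Set T.V} {A : Finset T.V} (hA : ∀ u ∈ A, below T u ⊆ S)
    (hanti : IsAntichain (AncestorOrEq T) (A : Set T.V)) : ∑ u ∈ A, weight T u ≤ S.ncard := by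
  have hdisj : (A : Set T.V).PairwiseDisjoint (below T) := fun u hu v hv huv =>
    disjoint_below (hanti hu hv huv) (hanti hv hu huv.symm)
  calc ∑ u ∈ A, weight T u = (⋃ u ∈ (A : Set T.V), below T u).ncard := by
        rw [A.finite_toSet.ncard_biUnion (fun _ _ => Set.toFinite _) hdisj, finsum_mem_coe_finset]
        rfl
    _ ≤ S.ncard := Set.ncard_le_ncard (Set.iUnion₂_subset hA) (Set.toFinite _)

end Cover

section Play

variable {T : RootedTree} {p : ℕ → Finset T.V} {f : ℕ → ℕ} {u v : T.V} {t m n : ℕ}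

theorem protectedBy_mono (h : m ≤ n) : protectedBy T p m ⊆ protectedBy T p n :=
  fun _ ⟨t, ht, hv⟩ => ⟨t, ht.trans_le h, hv⟩

theorem burnt_mono (h : m ≤ n) : burnt T p m ⊆ burnt T p n :=
  monotone_nat_of_le_succ (f := burnt T p) (fun _ => Set.subset_union_left) h

theorem level_le_of_mem_burnt (h : v ∈ burnt T p n) : level T v ≤ n := by
  induction n generalizing v with
  | zero =>
    obtain rfl : v = T.root := h
    exact level_root.le
  | succ n ih =>
    rcases h with h | ⟨⟨u, hu, huv⟩, -⟩
    · exact (ih h).trans n.le_succ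
    · rcases level_eq_of_adj huv with hl | hl <;> specialize ih hu <;> omega

theorem mem_burnt_level (h : ∀ u, AncestorOrEq T u v → u ∉ protectedBy T p (level T v)) :
    v ∈ burnt T p (level T v) := by
  induction hn : level T v generalizing v with
  | zero => exact level_eq_zero_iff.1 hn
  | succ n ih =>
    obtain ⟨w, hwv, hw⟩ := exists_parent hn
    have hmem : w ∈ burnt T p n :=
      ih (fun u hu hup => h u (hu.trans (.of_adj hwv (by omega)))
        (protectedBy_mono (by omega) hup)) hw
    exact .inr ⟨⟨w, hmem, hwv⟩, hn ▸ h v (.refl v)⟩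

namespace Legal

theorem eq_empty (hp : Legal T f p) (ht : f t = 0) : p t = ∅ :=
  Finset.card_eq_zero.1 (Nat.le_zero.1 (ht ▸ (hp t).1))

theorem notMem_burnt_self (hp : Legal T f p) (hu : u ∈ p t) (n : ℕ) : u ∉ burnt T p n := by
  induction n with
  | zero => exact fun h => ((hp t).2 u hu).1 (burnt_mono t.zero_le h)
  | succ n ih =>
    rcases le_or_gt (n + 1) t with hle | hlt
    · exact fun h => ((hp t).2 u hu).1 (burnt_mono hle h)
    · rintro (h | ⟨-, h⟩)
      · exact ih h
      · exact h ⟨t, hlt, hu⟩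

theorem notMem_burnt (hp : Legal T f p) (hu : u ∈ p t) (huv : AncestorOrEq T u v) (n : ℕ) :
    v ∉ burnt T p n := by
  induction n generalizing v with
  | zero =>
    rintro (rfl : v = T.root)
    obtain rfl := huv.eq_of_level_le (level_root.le.trans (Nat.zero_le _))
    exact hp.notMem_burnt_self hu 0 rfl
  | succ n ih =>
    rintro (hv | ⟨⟨w, hw, hwv⟩, hv⟩)
    · exact ih huv hv
    rcases level_eq_of_adj hwv with hl | hl
    · rcases (ancestorOrEq_iff_of_adj hwv hl).1 huv with rfl | huw
      · exact hp.notMem_burnt_self hu (n + 1) (.inr ⟨⟨w, hw, hwv⟩, hv⟩)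
      · exact ih huw hw
    · exact ih (huv.trans (.of_adj hwv.symm hl)) hw

theorem mem_burnt_iff (hp : Legal T f p) :
    v ∈ burnt T p n ↔ level T v ≤ n ∧ ∀ u, AncestorOrEq T u v → u ∉ protectedBy T p n := by
  constructor
  · refine fun h => ⟨level_le_of_mem_burnt h, ?_⟩
    rintro u huv ⟨t, -, hu⟩
    exact hp.notMem_burnt hu huv n h
  · rintro ⟨hl, h⟩
    exact burnt_mono hl (mem_burnt_level fun u hu hup => h u hu (protectedBy_mono hl hup))

end Legal

theorem legal_of_level (hcard : ∀ t, (p t).card ≤ f t)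
    (hmem : ∀ t, ∀ v ∈ p t, t < level T v ∧ v ∉ protectedBy T p t) : Legal T f p :=
  fun t => ⟨hcard t, fun v hv =>
    ⟨fun hb => (level_le_of_mem_burnt hb).not_gt (hmem t v hv).1, (hmem t v hv).2⟩⟩

theorem legal_empty (f : ℕ → ℕ) : Legal T f fun _ => ∅ := fun t => by simp

instance : Nonempty (Strategy T) := ⟨⟨fun _ _ => ∅, legal_empty, fun _ _ _ _ => rfl⟩⟩

end Play

section Saved

variable {T : RootedTree} {p : ℕ → Finset T.V} {f : ℕ → ℕ} {u v : T.V} {t : ℕ}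

/-- The vertices that never burn in the play `p`; `saved` counts them. -/
def savedSet (T : RootedTree) (p : ℕ → Finset T.V) : Set T.V := {v | ∀ n, v ∉ burnt T p n}

theorem Legal.mem_savedSet (hp : Legal T f p) (hu : u ∈ p t) (huv : AncestorOrEq T u v) :
    v ∈ savedSet T p := hp.notMem_burnt hu huv

-- A topmost protected ancestor cannot have been protected after the fire had reached its level.
theorem Legal.exists_ancestorOrEq_of_mem_savedSet (hp : Legal T f p) (hv : v ∈ savedSet T p) :
    ∃ t, ∃ u ∈ p t, t < level T u ∧ AncestorOrEq T u v := by
  obtain ⟨w, hwv, s, -, hw⟩ : ∃ w, AncestorOrEq T w v ∧ w ∈ protectedBy T p (level T v) := by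
    simpa only [hp.mem_burnt_iff, le_refl, true_and, not_forall, not_not, exists_prop]
      using hv (level T v)
  obtain ⟨u, ⟨huv, t, hu⟩, hmin⟩ := Set.exists_min_image
    {u | AncestorOrEq T u v ∧ ∃ t, u ∈ p t} (level T) (Set.toFinite _) ⟨w, hwv, s, hw⟩
  refine ⟨t, u, hu, lt_of_not_ge fun hle => ((hp t).2 u hu).1 ?_, huv⟩
  refine hp.mem_burnt_iff.2 ⟨hle, ?_⟩
  rintro x hxu ⟨r, hr, hx⟩
  obtain rfl : x = u := hxu.eq_of_level_le (hmin x ⟨hxu.trans huv, r, hx⟩)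
  exact ((hp t).2 x hu).2 ⟨r, hr, hx⟩

theorem Legal.below_subset_savedSet (hp : Legal T f p) (hu : u ∈ savedSet T p) :
    below T u ⊆ savedSet T p := by
  obtain ⟨t, w, hw, -, hwu⟩ := hp.exists_ancestorOrEq_of_mem_savedSet hu
  exact fun v huv => hp.mem_savedSet hw (hwu.trans huv)

theorem Legal.sum_weight_le_saved (hp : Legal T f p) {S : Finset T.V}
    (hS : ∀ v ∈ S, v ∈ savedSet T p) (hanti : IsAntichain (AncestorOrEq T) (S : Set T.V)) :
    ∑ v ∈ S, weight T v ≤ saved T p :=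
  sum_weight_le_ncard (fun v hv => hp.below_subset_savedSet (hS v hv)) hanti

open Classical in
/-- The ancestors of level `t + 1` of the vertices that `p` protects in turn `t` before the fire
can reach them. Protecting these ancestors instead would save at least as much. -/
def levelCover (T : RootedTree) (p : ℕ → Finset T.V) (t : ℕ) : Finset T.V :=
  ((p t).filter fun v => t < level T v).image (ancestorAt T (t + 1))

theorem ancestorAt_mem_levelCover (hv : v ∈ p t) (hl : t < level T v) :
    ancestorAt T (t + 1) v ∈ levelCover T p t := by
  classical
  exact Finset.mem_image_of_mem _ (Finset.mem_filter.2 ⟨hv, hl⟩)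

theorem level_of_mem_levelCover (hv : v ∈ levelCover T p t) : level T v = t + 1 := by
  classical
  obtain ⟨u, hu, rfl⟩ := Finset.mem_image.1 hv
  exact level_ancestorAt (Finset.mem_filter.1 hu).2

theorem Legal.card_levelCover_le (hp : Legal T f p) (t : ℕ) : (levelCover T p t).card ≤ f t := by
  classical
  exact Finset.card_image_le.trans ((Finset.card_filter_le _ _).trans (hp t).1)

theorem Legal.exists_mem_levelCover (hp : Legal T f p) (hv : v ∈ savedSet T p) :
    ∃ t, ∃ u ∈ levelCover T p t, AncestorOrEq T u v := by
  obtain ⟨t, u, hu, hl, huv⟩ := hp.exists_ancestorOrEq_of_mem_savedSet hv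
  exact ⟨t, _, ancestorAt_mem_levelCover hu hl, (ancestorAt_ancestorOrEq _ u).trans huv⟩

theorem Legal.saved_le_weight_add_sum (hp : Legal T f p) (F : Finset ℕ)
    (hF : ∀ t ∉ F, ∀ v ∈ levelCover T p t, AncestorOrEq T u v) :
    saved T p ≤ weight T u + ∑ t ∈ F, f t * maxWeightOff T u (t + 1) := by
  classical
  have hcover : ∀ v ∈ savedSet T p \ below T u, ∃ t ∈ F,
      ∃ w ∈ (levelCover T p t).filter (¬ AncestorOrEq T u ·), AncestorOrEq T w v := by
    rintro v ⟨hv, hvu⟩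
    obtain ⟨t, w, hw, hwv⟩ := hp.exists_mem_levelCover hv
    have huw : ¬ AncestorOrEq T u w := fun huw => hvu (huw.trans hwv)
    exact ⟨t, by_contra fun ht => huw (hF t ht w hw), w, Finset.mem_filter.2 ⟨hw, huw⟩, hwv⟩
  calc saved T p ≤ (below T u).ncard + (savedSet T p \ below T u).ncard := by
        rw [add_comm]
        exact Set.ncard_le_ncard_sdiff_add_ncard _ _
    _ ≤ weight T u +
          ∑ t ∈ F, ∑ w ∈ (levelCover T p t).filter (¬ AncestorOrEq T u ·), weight T w :=
        Nat.add_le_add_left (ncard_le_sum_weight hcover) _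
    _ ≤ weight T u + ∑ t ∈ F, f t * maxWeightOff T u (t + 1) := by
        gcongr with t
        refine (Finset.sum_le_card_nsmul _ _ (maxWeightOff T u (t + 1)) fun w hw => ?_).trans
          (Nat.mul_le_mul_right _ ((Finset.card_filter_le _ _).trans (hp.card_levelCover_le t)))
        rw [Finset.mem_filter] at hw
        exact level_of_mem_levelCover hw.1 ▸ weight_le_maxWeightOff hw.2

end Saved

section OfflineOpt

variable {T : RootedTree} {p : ℕ → Finset T.V} {f : ℕ → ℕ}

theorem bddAbove_saved (f : ℕ → ℕ) : BddAbove {s : ℕ | ∃ p, Legal T f p ∧ saved T p = s} := by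
  refine ⟨Nat.card T.V, ?_⟩
  rintro s ⟨p, -, rfl⟩
  exact Set.ncard_le_card _

theorem Legal.saved_le_offlineOpt (hp : Legal T f p) : saved T p ≤ offlineOpt T f :=
  le_csSup (bddAbove_saved f) ⟨p, hp, rfl⟩

theorem exists_saved_eq_offlineOpt (T : RootedTree) (f : ℕ → ℕ) :
    ∃ p, Legal T f p ∧ saved T p = offlineOpt T f :=
  Nat.sSup_mem (s := {s : ℕ | ∃ p, Legal T f p ∧ saved T p = s})
    ⟨_, _, legal_empty f, rfl⟩ (bddAbove_saved f)

end OfflineOpt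

section Ratio

variable {T : RootedTree} {k l : ℕ} {f : ℕ → ℕ} {c : ℝ}

theorem ratio_nonneg (A : Strategy T) (f : ℕ → ℕ) : 0 ≤ ratio T A f := by
  unfold ratio
  split_ifs <;> positivity

theorem ratio_le_one (A : Strategy T) (f : ℕ → ℕ) : ratio T A f ≤ 1 := by
  unfold ratio
  split_ifs
  · exact le_rfl
  · exact div_le_one_of_le₀ (mod_cast (A.legal f).saved_le_offlineOpt) (by positivity)

theorem le_ratio {A : Strategy T} (hc : c ≤ 1)
    (h : ∀ q, Legal T f q → c * saved T q ≤ saved T (A.play f)) : c ≤ ratio T A f := by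
  unfold ratio
  split_ifs with h0
  · exact hc
  · obtain ⟨q, hq, hs⟩ := exists_saved_eq_offlineOpt T f
    rw [le_div_iff₀ (by positivity), ← hs]
    exact h q hq

theorem ratio_le_div {A : Strategy T} {q : ℕ → Finset T.V} {m n : ℕ} (hq : Legal T f q)
    (hm : saved T (A.play f) ≤ m) (hn : n ≤ saved T q) (hpos : 0 < n) :
    ratio T A f ≤ (m : ℝ) / n := by
  have hopt : n ≤ offlineOpt T f := hn.trans hq.saved_le_offlineOpt
  rw [ratio, if_neg (by omega)]
  gcongr

theorem zero_mem_atMost (k : ℕ) : (fun _ => 0) ∈ atMost k := fun n => by simp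

instance (k : ℕ) : Nonempty (atMost k) := ⟨⟨_, zero_mem_atMost k⟩⟩

theorem atMost_mono (h : k ≤ l) : atMost k ⊆ atMost l := fun _ hf n => (hf n).trans h

theorem iInf_ratio_le {A : Strategy T} (hf : f ∈ atMost k) :
    ⨅ f : atMost k, ratio T A f ≤ ratio T A f :=
  ciInf_le (f := fun f : atMost k => ratio T A f)
    ⟨0, by rintro _ ⟨f, rfl⟩; exact ratio_nonneg A f⟩ ⟨f, hf⟩

theorem bddAbove_iInf_ratio (T : RootedTree) (k : ℕ) :
    BddAbove (Set.range fun A : Strategy T => ⨅ f : atMost k, ratio T A f) := by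
  refine ⟨1, ?_⟩
  rintro _ ⟨A, rfl⟩
  exact (iInf_ratio_le (zero_mem_atMost k)).trans (ratio_le_one _ _)

theorem treeValue_le (h : ∀ A : Strategy T, ∃ f ∈ atMost k, ratio T A f ≤ c) :
    treeValue k T ≤ c := by
  refine ciSup_le fun A => ?_
  obtain ⟨f, hf, hle⟩ := h A
  exact (iInf_ratio_le hf).trans hle

theorem le_treeValue (A : Strategy T) (h : ∀ f ∈ atMost k, c ≤ ratio T A f) :
    c ≤ treeValue k T :=
  le_ciSup_of_le (bddAbove_iInf_ratio T k) A (le_ciInf fun f => h f f.2)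

theorem treeValue_nonneg (k : ℕ) (T : RootedTree) : 0 ≤ treeValue k T :=
  le_treeValue (Classical.arbitrary _) fun _ _ => ratio_nonneg _ _

theorem treeValue_anti (T : RootedTree) (h : k ≤ l) : treeValue l T ≤ treeValue k T :=
  ciSup_le fun A => le_treeValue A fun _ hf => iInf_ratio_le (atMost_mono h hf)

instance : Nonempty RootedTree := ⟨W 1 1 1⟩

theorem alpha_le_treeValue (k : ℕ) (T : RootedTree) : alpha k ≤ treeValue k T :=
  ciInf_le ⟨0, by rintro _ ⟨T, rfl⟩; exact treeValue_nonneg k T⟩ T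

theorem alpha_anti (h : k ≤ l) : alpha l ≤ alpha k :=
  le_ciInf fun T => (alpha_le_treeValue l T).trans (treeValue_anti T h)

theorem Competitive.le_alpha {A : OnlineAlgorithm} {F : Set (ℕ → ℕ)} (h : Competitive A F c)
    (hF : atMost k ⊆ F) : c ≤ alpha k :=
  le_ciInf fun T => le_treeValue (A T) fun f hf => h.2.2 T f (hF hf)

end Ratio

section Construction

variable {α β : Type*} [Inhabited β] {move : (ℕ → β) → ℕ → α → β} {f g : ℕ → α}

/-- The moves that the rule `move` makes on the input `f`: the move at time `t` depends on the
earlier moves, on `t` and on `f t`. The entries of the history from time `t` on are `default`. -/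
def playOf (move : (ℕ → β) → ℕ → α → β) (f : ℕ → α) (t : ℕ) : β :=
  move (fun s => if s < t then playOf move f s else default) t (f t)

theorem playOf_congr {t : ℕ} (h : ∀ s ≤ t, f s = g s) : playOf move f t = playOf move g t := by
  induction t using Nat.strong_induction_on with
  | _ t ih =>
    rw [playOf, playOf, h t le_rfl]
    congr 1
    funext s
    split_ifs with hs
    · exact ih s hs fun r hr => h r (hr.trans hs.le)
    · rfl

theorem exists_strategy {T : RootedTree}
    (R : (ℕ → Finset T.V) → ℕ → ℕ → Finset T.V → Prop)
    (hcongr : ∀ p q t n X, (∀ s < t, p s = q s) → R p t n X → R q t n X)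
    (hex : ∀ (f : ℕ → ℕ) p t, (∀ s < t, R p s (f s) (p s)) → ∃ X, R p t (f t) X)
    (hlegal : ∀ f p, (∀ t, R p t (f t) (p t)) → Legal T f p) :
    ∃ A : Strategy T, ∀ f t, R (A.play f) t (f t) (A.play f t) := by
  set play := playOf fun p t n => Classical.epsilon (R p t n)
  have hR : ∀ f t, R (play f) t (f t) (play f t) := by
    intro f t
    induction t using Nat.strong_induction_on with
    | _ t ih =>
      obtain ⟨X, hX⟩ := hex f (play f) t ih
      have hhist : ∀ s < t, (if s < t then play f s else default) = play f s :=
        fun s hs => if_pos hs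
      refine hcongr _ _ t _ _ hhist ?_
      simp only [play]
      rw [playOf]
      exact Classical.epsilon_spec ⟨X, hcongr _ _ t _ _ (fun s hs => (hhist s hs).symm) hX⟩
  exact ⟨⟨play, fun f => hlegal f _ (hR f), fun _ _ _ => playOf_congr⟩, hR⟩

end Construction

section Greedy

variable {T : RootedTree} {A : Strategy T} {f : ℕ → ℕ} {p q : ℕ → Finset T.V} {t : ℕ}

theorem protectedBy_congr (h : ∀ s < t, p s = q s) : protectedBy T p t = protectedBy T q t := by
  ext v
  exact exists_congr fun s => and_congr_right fun hs => by rw [h s hs]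

theorem exists_greedyFeasible_max (p : ℕ → Finset T.V) (t n : ℕ) :
    ∃ X, GreedyFeasible T p t n X ∧
      ∀ Y, GreedyFeasible T p t n Y → ∑ v ∈ Y, weight T v ≤ ∑ v ∈ X, weight T v :=
  Set.exists_max_image {X | GreedyFeasible T p t n X} (fun X => ∑ v ∈ X, weight T v)
    (Set.toFinite _) ⟨∅, by simp [GreedyFeasible]⟩

theorem legal_of_greedyFeasible (h : ∀ t, GreedyFeasible T p t (f t) (p t)) : Legal T f p := by
  refine legal_of_level (fun t => (h t).1) fun t v hv => ?_
  have hlv := ((h t).2 v hv).1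
  refine ⟨by omega, ?_⟩
  rintro ⟨s, hs, hvs⟩
  have hlv' := ((h s).2 v hvs).1
  omega

theorem exists_isGreedyOn (T : RootedTree) : ∃ A : Strategy T, IsGreedyOn T A := by
  refine exists_strategy (fun p t n X => GreedyFeasible T p t n X ∧
      ∀ Y, GreedyFeasible T p t n Y → ∑ v ∈ Y, weight T v ≤ ∑ v ∈ X, weight T v)
    (fun p q t n X hpq => ?_) (fun f p t _ => exists_greedyFeasible_max p t (f t))
    fun f p hp => legal_of_greedyFeasible fun t => (hp t).1
  simp only [GreedyFeasible, protectedBy_congr hpq]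
  exact id

theorem exists_isGreedy : ∃ A, IsGreedy A := by
  choose A hA using exists_isGreedyOn
  exact ⟨A, hA⟩

open Classical in
theorem greedyFeasible_levelCover (hq : Legal T f q) (hp : Legal T f p) (t : ℕ) :
    GreedyFeasible T p t (f t) ((levelCover T q t).filter (· ∉ savedSet T p)) := by
  refine ⟨(Finset.card_filter_le _ _).trans (hq.card_levelCover_le t), fun v hv => ?_⟩
  obtain ⟨hvq, hvp⟩ := Finset.mem_filter.1 hv
  refine ⟨level_of_mem_levelCover hvq, ?_⟩
  rintro u huv - ⟨s, -, hu⟩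
  exact hvp (hp.mem_savedSet hu huv)

namespace IsGreedyOn

theorem level_eq (hA : IsGreedyOn T A) {v : T.V} (hv : v ∈ A.play f t) : level T v = t + 1 :=
  ((hA f t).1.2 v hv).1

theorem not_ancestorOrEq (hA : IsGreedyOn T A) {s t : ℕ} {u v : T.V} (hu : u ∈ A.play f s)
    (hv : v ∈ A.play f t) (hne : u ≠ v) : ¬ AncestorOrEq T u v := by
  intro h
  have hlt := h.level_lt hne
  rw [hA.level_eq hu, hA.level_eq hv] at hlt
  exact ((hA f t).1.2 v hv).2 u h hne ⟨s, by omega, hu⟩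

theorem sum_weight_le_saved (hA : IsGreedyOn T A) (f : ℕ → ℕ) (n : ℕ) :
    ∑ t ∈ Finset.range n, ∑ v ∈ A.play f t, weight T v ≤ saved T (A.play f) := by
  classical
  have hdisj : Set.PairwiseDisjoint (Finset.range n : Set ℕ) (A.play f) := by
    refine fun s _ t _ hst => Finset.disjoint_left.2 fun v hs ht => hst ?_
    have hls := hA.level_eq hs
    have hlt := hA.level_eq ht
    omega
  rw [← Finset.sum_biUnion hdisj]
  have hmem : ∀ v ∈ (Finset.range n).biUnion (A.play f), ∃ t, v ∈ A.play f t := by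
    intro v hv
    obtain ⟨t, -, ht⟩ := Finset.mem_biUnion.1 hv
    exact ⟨t, ht⟩
  refine (A.legal f).sum_weight_le_saved (fun v hv => ?_) fun u hu v hv hne => ?_
  · obtain ⟨t, ht⟩ := hmem v hv
    exact (A.legal f).mem_savedSet ht (.refl v)
  · obtain ⟨s, hs⟩ := hmem u hu
    obtain ⟨t, ht⟩ := hmem v hv
    exact hA.not_ancestorOrEq hs ht hne

-- What the greedy play loses to `q` is covered by vertices it could have chosen instead of its own.
theorem saved_le_two_mul (hA : IsGreedyOn T A) (hq : Legal T f q) :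
    saved T q ≤ 2 * saved T (A.play f) := by
  classical
  set p := A.play f
  have hp : Legal T f p := A.legal f
  have hcover : ∀ v ∈ savedSet T q \ savedSet T p, ∃ t ∈ Finset.range (height T),
      ∃ u ∈ (levelCover T q t).filter (· ∉ savedSet T p), AncestorOrEq T u v := by
    rintro v ⟨hvq, hvp⟩
    obtain ⟨t, u, hu, huv⟩ := hq.exists_mem_levelCover hvq
    have hlu := level_of_mem_levelCover hu ▸ level_le_height u
    exact ⟨t, Finset.mem_range.2 hlu, u,
      Finset.mem_filter.2 ⟨hu, fun hup => hvp (hp.below_subset_savedSet hup huv)⟩, huv⟩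
  calc saved T q ≤ (savedSet T q \ savedSet T p).ncard + saved T p :=
        Set.ncard_le_ncard_sdiff_add_ncard _ _
    _ ≤ ∑ t ∈ Finset.range (height T),
          ∑ u ∈ (levelCover T q t).filter (· ∉ savedSet T p), weight T u + saved T p :=
        Nat.add_le_add_right (ncard_le_sum_weight hcover) _
    _ ≤ ∑ t ∈ Finset.range (height T), ∑ u ∈ p t, weight T u + saved T p :=
        Nat.add_le_add_right (Finset.sum_le_sum fun t _ =>
          (hA f t).2 _ (greedyFeasible_levelCover hq hp t)) _
    _ ≤ saved T p + saved T p := Nat.add_le_add_right (hA.sum_weight_le_saved f _) _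
    _ = 2 * saved T p := (two_mul _).symm

end IsGreedyOn

theorem IsGreedy.competitive {A : OnlineAlgorithm} (hA : IsGreedy A) (F : Set (ℕ → ℕ)) :
    Competitive A F (1 / 2) := by
  refine ⟨by norm_num, by norm_num, fun T f _ => le_ratio (by norm_num) fun q hq => ?_⟩
  have hle : (saved T q : ℝ) ≤ 2 * saved T ((A T).play f) := mod_cast (hA T).saved_le_two_mul hq
  linarith

end Greedy

section TwoFirefightersExistence

variable {T : RootedTree} {p q : ℕ → Finset T.V}

theorem protectedBy_zero : protectedBy T p 0 = ∅ :=
  Set.eq_empty_of_forall_notMem fun _ ⟨_, h, _⟩ => Nat.not_lt_zero _ h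

theorem protectedBy_succ (n : ℕ) : protectedBy T p (n + 1) = protectedBy T p n ∪ p n := by
  ext v
  simp only [protectedBy, Set.mem_ofPred_eq, Set.mem_union, Finset.mem_coe,
    Nat.exists_lt_succ_right]

theorem burnt_congr {t : ℕ} (h : ∀ s < t, p s = q s) : burnt T p t = burnt T q t := by
  induction t with
  | zero => rfl
  | succ t ih => simp only [burnt, ih fun s hs => h s (by omega), protectedBy_congr h]

theorem exists_isTopPair {C : Set T.V} (hC : C.Nonempty) : ∃ a b, IsTopPair T C a b := by
  obtain ⟨a, ha, hmax⟩ := Set.exists_max_image C (weight T) (Set.toFinite _) hC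
  rcases (C \ {a}).eq_empty_or_nonempty with h | h
  · have hCa : C = {a} := (Set.sdiff_eq_empty.1 h).antisymm (Set.singleton_subset_iff.2 ha)
    exact ⟨a, a, ha, ha, hmax, fun u hu hne => absurd (hCa.subset hu) hne, fun _ => hCa⟩
  · obtain ⟨b, hb, hbmax⟩ := Set.exists_max_image (C \ {a}) (weight T) (Set.toFinite _) h
    exact ⟨a, b, ha, hb.1, hmax, fun u hu hne => hbmax u ⟨hu, hne⟩, fun hab => absurd hab.symm hb.2⟩

theorem exists_choice (t : ℕ) {B Q : Set T.V} (h : (children T B Q).Nonempty) :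
    ∃ v ∈ children T B Q, Choice T t B Q v := by
  by_cases hQ : Q = ∅
  · obtain ⟨a, b, hab⟩ := exists_isTopPair h
    by_cases ht : FirstTest T t a b
    · exact ⟨a, hab.1, fun _ => ⟨a, b, hab, fun _ => rfl, fun h => absurd ht h⟩,
        fun h => absurd hQ h⟩
    · exact ⟨b, hab.2.1, fun _ => ⟨a, b, hab, fun h => absurd h ht, fun _ => rfl⟩,
        fun h => absurd hQ h⟩
  · obtain ⟨v, hv, hmax⟩ := Set.exists_max_image _ (weight T) (Set.toFinite _) h
    exact ⟨v, hv, fun h => absurd h hQ, fun _ => ⟨hv, hmax⟩⟩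

theorem exists_serve (t : ℕ) (B Q : Set T.V) (n : ℕ) :
    ∃ X : Finset T.V, Serve T t B Q n (Q ∪ X) ∧ X.card ≤ n ∧ ∀ v ∈ X, v ∉ B ∧ v ∉ Q := by
  classical
  induction n generalizing Q with
  | zero => exact ⟨∅, by simpa using Serve.done Q, by simp, by simp⟩
  | succ n ih =>
    rcases Set.eq_empty_or_nonempty (children T B Q) with hC | hC
    · obtain ⟨X, hX, hcard, hmem⟩ := ih Q
      exact ⟨X, .skip Q _ n hC hX, by omega, hmem⟩
    · obtain ⟨v, hv, hch⟩ := exists_choice t hC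
      obtain ⟨X, hX, hcard, hmem⟩ := ih (insert v Q)
      refine ⟨insert v X, .place Q _ n v hC hch ?_, ?_, ?_⟩
      · rwa [Finset.coe_insert, Set.union_insert, ← Set.insert_union]
      · exact (Finset.card_insert_le _ _).trans (by omega)
      · intro u hu
        rcases Finset.mem_insert.1 hu with rfl | hu
        · exact ⟨hv.1, hv.2.1⟩
        · exact ⟨(hmem u hu).1, fun h => (hmem u hu).2 (Set.mem_insert_of_mem _ h)⟩

theorem exists_isTwoFirefighterOn (T : RootedTree) :
    ∃ A : Strategy T, IsTwoFirefighterOn T A := by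
  obtain ⟨A, hA⟩ := exists_strategy (T := T) (fun p t n X =>
    Serve T t (burnt T p t) (protectedBy T p t) n (protectedBy T p t ∪ X) ∧ X.card ≤ n ∧
      ∀ v ∈ X, v ∉ burnt T p t ∧ v ∉ protectedBy T p t)
    (fun p q t n X hpq => by
      simp only [protectedBy_congr hpq, burnt_congr hpq]
      exact id)
    (fun f p t _ => exists_serve t _ _ _) (fun f p hp t => (hp t).2)
  refine ⟨A, fun f t => ?_⟩
  rw [protectedBy_succ]
  exact (hA f t).1

theorem exists_isTwoFirefighterAlgorithm : ∃ A, IsTwoFirefighterAlgorithm A := by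
  choose A hA using exists_isTwoFirefighterOn
  exact ⟨A, hA⟩

end TwoFirefightersExistence

section FirstPlacement

variable {T : RootedTree} {t j : ℕ} {a b c u : T.V}

theorem weight_le_of_isTopPair {C : Set T.V} (h : IsTopPair T C a b) (hu : u ∈ C) :
    weight T u ≤ weight T a := h.2.2.1 u hu

theorem firstTest_self (t : ℕ) (a : T.V) : FirstTest T t a a := by
  intro j _ _
  have hpos : (0 : ℝ) < weight T a := mod_cast weight_pos a
  rw [div_self (by positivity), div_le_one (by positivity)]
  exact Real.one_lt_goldenRatio.le

theorem maxWeightBelow_eq_zero (h : height T < j) : maxWeightBelow T u j = 0 :=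
  Nat.le_zero.1 (maxWeightBelow_le fun v _ hv => absurd (level_le_height v) (by omega))

theorem maxWeightBelow_le_weight (u : T.V) (j : ℕ) : maxWeightBelow T u j ≤ weight T u :=
  maxWeightBelow_le fun _ huv _ => weight_le_weight huv

theorem maxWeightBelow_le_maxWeightOff (hl : level T u = level T c) (hne : u ≠ c) (j : ℕ) :
    maxWeightBelow T u j ≤ maxWeightOff T c j := by
  refine maxWeightBelow_le fun v huv hv => ?_
  exact hv ▸ weight_le_maxWeightOff fun hcv => hne (huv.eq_of_level_eq hcv hl)

theorem maxWeightOff_le_max (u c : T.V) (j : ℕ) :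
    maxWeightOff T u j ≤ max (maxWeightOff T c j) (maxWeightBelow T c j) := by
  refine maxWeightOff_le fun v _ hv => ?_
  by_cases hcv : AncestorOrEq T c v
  · exact le_max_of_le_right (hv ▸ weight_le_maxWeightBelow hcv)
  · exact le_max_of_le_left (hv ▸ weight_le_maxWeightOff hcv)

theorem FirstTest.weight_add_maxWeightBelow_le (h : FirstTest T t a b)
    (hba : weight T b ≤ weight T a) (hj : t + 2 ≤ j) :
    (weight T b : ℝ) + maxWeightBelow T a j ≤
      Real.goldenRatio * (weight T a + maxWeightBelow T b j) := by
  have hb : (0 : ℝ) < weight T b := mod_cast weight_pos b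
  rcases le_or_gt j (height T + 1) with hjh | hjh
  · have htest := h j hj hjh
    rwa [div_le_div_iff₀ Real.goldenRatio_pos (by positivity), one_mul, mul_comm] at htest
  · have hba' : (weight T b : ℝ) ≤ weight T a := mod_cast hba
    rw [maxWeightBelow_eq_zero (by omega), maxWeightBelow_eq_zero (by omega), Nat.cast_zero,
      add_zero, add_zero]
    nlinarith [Real.one_lt_goldenRatio]

theorem exists_lt_of_not_firstTest (h : ¬ FirstTest T t a b) :
    ∃ i, t + 2 ≤ i ∧ Real.goldenRatio * ((weight T a : ℝ) + maxWeightBelow T b i) <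
      weight T b + maxWeightBelow T a i := by
  unfold FirstTest at h
  push Not at h
  obtain ⟨i, hi, -, hlt⟩ := h
  have hb : (0 : ℝ) < weight T b := mod_cast weight_pos b
  rw [div_lt_div_iff₀ (by positivity) Real.goldenRatio_pos, one_mul, mul_comm] at hlt
  exact ⟨i, hi, hlt⟩

theorem weight_le_of_not_firstTest (h : ¬ FirstTest T t a b) :
    (weight T a : ℝ) ≤ Real.goldenRatio * weight T b := by
  obtain ⟨i, -, hi⟩ := exists_lt_of_not_firstTest h
  have hle : (maxWeightBelow T a i : ℝ) ≤ weight T a := mod_cast maxWeightBelow_le_weight a i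
  have hφ := Real.one_lt_goldenRatio
  have hsub : (Real.goldenRatio - 1) * weight T a ≤ weight T b := by
    nlinarith [(maxWeightBelow T b i).cast_nonneg (α := ℝ)]
  calc (weight T a : ℝ) = Real.goldenRatio * ((Real.goldenRatio - 1) * weight T a) := by
        linear_combination -(weight T a : ℝ) * Real.goldenRatio_sq
    _ ≤ Real.goldenRatio * weight T b := by gcongr

/-- `c` is a vertex on which the two-firefighter algorithm may place the first firefighter, if it
arrives in turn `t`: the vertices with a burning neighbour are then those of level `t + 1`. -/
def IsFirstPlacement (T : RootedTree) (t : ℕ) (c : T.V) : Prop :=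
  ∃ a b, IsTopPair T {v | level T v = t + 1} a b ∧
    (c = a ∧ FirstTest T t a b ∨ c = b ∧ a ≠ b ∧ ¬ FirstTest T t a b)

namespace IsFirstPlacement

theorem level_eq (h : IsFirstPlacement T t c) : level T c = t + 1 := by
  obtain ⟨a, b, hab, ⟨rfl, -⟩ | ⟨rfl, -⟩⟩ := h
  exacts [hab.1, hab.2.1]

theorem weight_le (h : IsFirstPlacement T t c) (hu : level T u = t + 1) :
    (weight T u : ℝ) ≤ Real.goldenRatio * weight T c := by
  obtain ⟨a, b, hab, hc⟩ := h
  have hua : (weight T u : ℝ) ≤ weight T a := mod_cast weight_le_of_isTopPair hab hu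
  rcases hc with ⟨rfl, -⟩ | ⟨rfl, -, htest⟩
  · exact hua.trans (le_mul_of_one_le_left (by positivity) Real.one_lt_goldenRatio.le)
  · exact hua.trans (weight_le_of_not_firstTest htest)

end IsFirstPlacement

theorem weight_add_maxWeightBelow_le_of_firstTest
    (hab : IsTopPair T {v | level T v = t + 1} a b) (htest : FirstTest T t a b)
    (hu : level T u = t + 1) (hua : u ≠ a) (hj : t + 2 ≤ j) :
    (weight T u : ℝ) + maxWeightBelow T a j ≤
      Real.goldenRatio * (weight T a + maxWeightOff T a j) := by
  have hba : b ≠ a := by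
    rintro rfl
    have huC : u ∈ ({b} : Set T.V) := hab.2.2.2.2 rfl ▸ hu
    exact hua huC
  have hub : (weight T u : ℝ) ≤ weight T b := mod_cast hab.2.2.2.1 u hu hua
  have hoff : (maxWeightBelow T b j : ℝ) ≤ maxWeightOff T a j :=
    mod_cast maxWeightBelow_le_maxWeightOff (hab.2.1.trans hab.1.symm) hba j
  calc (weight T u : ℝ) + maxWeightBelow T a j ≤ weight T b + maxWeightBelow T a j := by gcongr
    _ ≤ Real.goldenRatio * (weight T a + maxWeightBelow T b j) :=
      htest.weight_add_maxWeightBelow_le (weight_le_of_isTopPair hab hab.2.1) hj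
    _ ≤ Real.goldenRatio * (weight T a + maxWeightOff T a j) := by gcongr

-- The test fails at some level `i`; `i ≤ j` bounds `maxWeightBelow T b j`, `j ≤ i` bounds `w_a`.
theorem weight_add_maxWeightBelow_le_of_not_firstTest
    (hab : IsTopPair T {v | level T v = t + 1} a b) (hne : a ≠ b) (htest : ¬ FirstTest T t a b)
    (hu : level T u = t + 1) (hj : t + 2 ≤ j) :
    (weight T u : ℝ) + maxWeightBelow T b j ≤
      Real.goldenRatio * (weight T b + maxWeightOff T b j) := by
  have hla : level T a = t + 1 := hab.1
  have hlb : level T b = t + 1 := hab.2.1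
  obtain ⟨i, hi, hlt⟩ := exists_lt_of_not_firstTest htest
  have hφ := Real.one_lt_goldenRatio
  have hφ2 := Real.goldenRatio_sq
  have hua : (weight T u : ℝ) ≤ weight T a := mod_cast weight_le_of_isTopPair hab hu
  have hM : (0 : ℝ) ≤ maxWeightOff T b j := Nat.cast_nonneg _
  refine le_of_mul_le_mul_left ?_ Real.goldenRatio_pos
  rcases le_total i j with hij | hji
  · have hbelow : (maxWeightBelow T b j : ℝ) ≤ maxWeightBelow T b i :=
      mod_cast maxWeightBelow_anti (by omega) hij
    have hai : (maxWeightBelow T a i : ℝ) ≤ weight T a := mod_cast maxWeightBelow_le_weight a i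
    have hw := weight_le_of_not_firstTest htest
    calc Real.goldenRatio * (weight T u + maxWeightBelow T b j)
        ≤ Real.goldenRatio * (weight T a + maxWeightBelow T b i) := by gcongr
      _ ≤ weight T b + Real.goldenRatio * weight T b := by linarith
      _ = Real.goldenRatio * (Real.goldenRatio * weight T b) := by
        linear_combination -(weight T b : ℝ) * hφ2
      _ ≤ Real.goldenRatio * (Real.goldenRatio * (weight T b + maxWeightOff T b j)) := by
        gcongr
        exact le_add_of_nonneg_right hM
  · have hoff : (maxWeightBelow T a i : ℝ) ≤ maxWeightOff T b j :=
      mod_cast (maxWeightBelow_anti (by omega) hji).trans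
        (maxWeightBelow_le_maxWeightOff (hla.trans hlb.symm) hne j)
    have hb : (maxWeightBelow T b j : ℝ) ≤ weight T b := mod_cast maxWeightBelow_le_weight b j
    calc Real.goldenRatio * (weight T u + maxWeightBelow T b j)
        ≤ Real.goldenRatio * (weight T a + weight T b) := by gcongr
      _ ≤ (weight T b + maxWeightOff T b j) + Real.goldenRatio * weight T b := by
        nlinarith [(maxWeightBelow T b i).cast_nonneg (α := ℝ)]
      _ ≤ Real.goldenRatio * (Real.goldenRatio * (weight T b + maxWeightOff T b j)) := by
        nlinarith

theorem IsFirstPlacement.weight_add_maxWeightOff_le (h : IsFirstPlacement T t c)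
    (hu : level T u = t + 1) (hj : t + 2 ≤ j) :
    (weight T u : ℝ) + maxWeightOff T u j ≤
      Real.goldenRatio * (weight T c + maxWeightOff T c j) := by
  have hφ := Real.one_lt_goldenRatio
  by_cases huc : u = c
  · subst huc
    exact le_mul_of_one_le_left (by positivity) hφ.le
  rcases le_max_iff.1 (maxWeightOff_le_max u c j) with hoff | hbelow
  · have hoff' : (maxWeightOff T u j : ℝ) ≤ maxWeightOff T c j := mod_cast hoff
    rw [mul_add]
    exact add_le_add (h.weight_le hu)
      (hoff'.trans (le_mul_of_one_le_left (by positivity) hφ.le))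
  · have hbelow' : (maxWeightOff T u j : ℝ) ≤ maxWeightBelow T c j := mod_cast hbelow
    refine (add_le_add_right hbelow' _).trans ?_
    obtain ⟨a, b, hab, ⟨rfl, htest⟩ | ⟨rfl, hne, htest⟩⟩ := h
    · exact weight_add_maxWeightBelow_le_of_firstTest hab htest hu huc hj
    · exact weight_add_maxWeightBelow_le_of_not_firstTest hab hne htest hu hj

end FirstPlacement

section Children

variable {T : RootedTree} {p : ℕ → Finset T.V} {f : ℕ → ℕ} {t m n : ℕ} {c v : T.V}

theorem children_insert (B Q : Set T.V) (c : T.V) :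
    children T B (insert c Q) = children T B Q \ {c} := by
  ext v
  simp only [children, Set.mem_ofPred_eq, Set.mem_insert_iff, Set.mem_sdiff,
    Set.mem_singleton_iff]
  tauto

theorem Legal.mem_children_iff (hp : Legal T f p) :
    v ∈ children T (burnt T p t) (protectedBy T p t) ↔
      level T v = t + 1 ∧ ∀ u, AncestorOrEq T u v → u ∉ protectedBy T p t := by
  constructor
  · rintro ⟨hB, hQ, w, hw, hwv⟩
    obtain ⟨hlw, hprot⟩ := hp.mem_burnt_iff.1 hw
    have hanc : ∀ u, AncestorOrEq T u v → u ∉ protectedBy T p t := by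
      rintro u huv hu
      rcases level_eq_of_adj hwv with hl | hl
      · rcases (ancestorOrEq_iff_of_adj hwv hl).1 huv with rfl | huw
        exacts [hQ hu, hprot u huw hu]
      · exact hprot u (huv.trans (.of_adj hwv.symm hl)) hu
    have hlv : ¬ level T v ≤ t := fun hl => hB (hp.mem_burnt_iff.2 ⟨hl, hanc⟩)
    exact ⟨by have := level_eq_of_adj hwv; omega, hanc⟩
  · rintro ⟨hl, hanc⟩
    obtain ⟨w, hwv, hwl⟩ := exists_parent hl
    refine ⟨fun hB => ?_, hanc v (.refl v), w, hp.mem_burnt_iff.2 ⟨hwl.le, fun u hu => ?_⟩, hwv⟩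
    · exact (level_le_of_mem_burnt hB).not_gt (by omega)
    · exact hanc u (hu.trans (.of_adj hwv (by omega)))

theorem Legal.children_eq_of_protectedBy_eq_empty (hp : Legal T f p)
    (h : protectedBy T p t = ∅) : children T (burnt T p t) ∅ = {v | level T v = t + 1} := by
  ext v
  rw [← h, hp.mem_children_iff, h]
  simp only [Set.mem_empty_iff_false, not_false_eq_true, implies_true, and_true,
    Set.mem_ofPred_eq]

theorem Legal.children_eq_of_protectedBy_eq_singleton (hp : Legal T f p)
    (h : protectedBy T p t = {c}) :
    children T (burnt T p t) {c} = {v | level T v = t + 1 ∧ ¬ AncestorOrEq T c v} := by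
  ext v
  rw [← h, hp.mem_children_iff, h]
  simp only [Set.mem_singleton_iff, imp_not_comm, forall_eq, Set.mem_ofPred_eq]

theorem Legal.protectedBy_eq (hp : Legal T f p) (hmn : m ≤ n)
    (h : ∀ r, m ≤ r → r < n → f r = 0) : protectedBy T p n = protectedBy T p m := by
  refine (protectedBy_mono hmn).antisymm' ?_
  rintro v ⟨r, hr, hv⟩
  refine ⟨r, lt_of_not_ge fun hmr => ?_, hv⟩
  rw [hp.eq_empty (h r hmr hr)] at hv
  exact Finset.notMem_empty v hv

end Children

section Serving

variable {T : RootedTree} {t n : ℕ} {a b v : T.V} {B C Q Q' : Set T.V}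

theorem serve_zero_iff : Serve T t B Q 0 Q' ↔ Q' = Q := by
  constructor
  · rintro ⟨⟩
    rfl
  · rintro rfl
    exact .done Q'

theorem serve_succ_iff : Serve T t B Q (n + 1) Q' ↔
    children T B Q = ∅ ∧ Serve T t B Q n Q' ∨
      ∃ v, (children T B Q).Nonempty ∧ Choice T t B Q v ∧ Serve T t B (insert v Q) n Q' := by
  constructor
  · rintro (_ | ⟨_, _, _, hC, hn⟩ | ⟨_, _, _, v, hC, hv, hn⟩)
    exacts [.inl ⟨hC, hn⟩, .inr ⟨v, hC, hv, hn⟩]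
  · rintro (⟨hC, hn⟩ | ⟨v, hC, hv, hn⟩)
    exacts [.skip Q Q' n hC hn, .place Q Q' n v hC hv hn]

theorem Choice.exists_isTopPair (h : Choice T t B ∅ v) :
    ∃ a b, IsTopPair T (children T B ∅) a b ∧
      (v = a ∧ FirstTest T t a b ∨ v = b ∧ a ≠ b ∧ ¬ FirstTest T t a b) := by
  obtain ⟨a, b, hab, ha, hb⟩ := h.1 rfl
  refine ⟨a, b, hab, ?_⟩
  by_cases htest : FirstTest T t a b
  · exact .inl ⟨ha htest, htest⟩
  · exact .inr ⟨hb htest, fun h => htest (h ▸ firstTest_self t a), htest⟩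

theorem Choice.isFirstPlacement (h : Choice T t B ∅ v)
    (hC : children T B ∅ = {u | level T u = t + 1}) : IsFirstPlacement T t v := by
  unfold IsFirstPlacement
  exact hC ▸ h.exists_isTopPair

theorem sum_weight_le_of_isTopPair (h : IsTopPair T C a b) {X : Finset T.V} (hX : ↑X ⊆ C)
    (hcard : X.card ≤ 2) : ∑ x ∈ X, weight T x ≤ weight T a + weight T b := by
  classical
  have hrest : ∑ x ∈ X.erase a, weight T x ≤ (X.erase a).card * weight T b :=
    Finset.sum_le_card_nsmul _ _ _ fun x hx =>
      h.2.2.2.1 x (hX (Finset.mem_of_mem_erase hx)) (Finset.ne_of_mem_erase hx)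
  by_cases ha : a ∈ X
  · rw [← Finset.add_sum_erase _ _ ha]
    have hone : (X.erase a).card ≤ 1 := by
      rw [Finset.card_erase_of_mem ha]
      omega
    exact Nat.add_le_add_left (hrest.trans (mul_le_of_le_one_left (Nat.zero_le _) hone)) _
  · rw [Finset.erase_eq_of_notMem ha] at hrest
    have hba := weight_le_of_isTopPair h h.2.1
    nlinarith

theorem Serve.exists_sum_weight_le (h : Serve T t B ∅ 2 Q') {X : Finset T.V}
    (hX : ↑X ⊆ children T B ∅) (hcard : X.card ≤ 2) :
    ∃ Y : Finset T.V, ↑Y ⊆ children T B ∅ ∩ Q' ∧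
      ∑ x ∈ X, weight T x ≤ ∑ y ∈ Y, weight T y := by
  classical
  rcases serve_succ_iff.1 h with ⟨hC, -⟩ | ⟨c, -, hc, h⟩
  · exact ⟨∅, by simp, Finset.sum_le_sum_of_subset (by simpa [hC] using hX)⟩
  obtain ⟨a, b, hab, hcab⟩ := hc.exists_isTopPair
  have hcC : c ∈ children T B ∅ := by
    rcases hcab with ⟨rfl, -⟩ | ⟨rfl, -⟩
    exacts [hab.1, hab.2.1]
  rcases serve_succ_iff.1 h with ⟨hC, h⟩ | ⟨z, -, hz, h⟩ <;> obtain rfl := serve_zero_iff.1 h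
  · rw [children_insert, Set.sdiff_eq_empty] at hC
    refine ⟨{c}, by simpa using hcC, Finset.sum_le_sum_of_subset ?_⟩
    exact_mod_cast hX.trans hC
  obtain ⟨hzC, hzmax⟩ := hz.2 (Set.insert_nonempty _ _).ne_empty
  rw [children_insert] at hzC hzmax
  refine ⟨{c, z}, ?_, (sum_weight_le_of_isTopPair hab hX hcard).trans ?_⟩
  · rintro y hy
    rcases (by simpa using hy : y = c ∨ y = z) with rfl | rfl
    exacts [⟨hcC, by simp⟩, ⟨hzC.1, by simp⟩]
  rw [Finset.sum_pair (Ne.symm hzC.2)]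
  have hne : a ≠ b := by
    rintro rfl
    have hCa := hab.2.2.2.2 rfl
    exact hzC.2 ((hCa.subset hzC.1).trans (hCa.subset hcC).symm)
  rcases hcab with ⟨rfl, -⟩ | ⟨rfl, -⟩
  · exact Nat.add_le_add_left (hzmax b ⟨hab.2.1, hne.symm⟩) _
  · rw [add_comm]
    exact Nat.add_le_add_left (hzmax a ⟨hab.1, hne⟩) _

end Serving

section FewFirefighters

variable {T : RootedTree} {p q : ℕ → Finset T.V} {f : ℕ → ℕ} {s t : ℕ} {c v : T.V}

theorem eq_zero_or_of_mem_atMost_two (hf : f ∈ atMost 2) :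
    (∀ r, f r = 0) ∨ (∃ t, f t = 2 ∧ ∀ r, r ≠ t → f r = 0) ∨
      ∃ t s, t < s ∧ f t = 1 ∧ f s ≤ 1 ∧ ∀ r, r ≠ t → r ≠ s → f r = 0 := by
  classical
  by_cases hzero : ∀ r, f r = 0
  · exact .inl hzero
  push Not at hzero
  obtain ⟨t, ht, hbefore⟩ : ∃ t, f t ≠ 0 ∧ ∀ r < t, f r = 0 :=
    ⟨Nat.find hzero, Nat.find_spec hzero, fun r hr => not_not.1 (Nat.find_min hzero hr)⟩
  have hsum (S : Finset ℕ) : ∑ r ∈ S, f r ≤ 2 := by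
    obtain ⟨n, hn⟩ := S.exists_nat_subset_range
    exact (Finset.sum_le_sum_of_subset hn).trans (hf n)
  have hpair {r : ℕ} (hr : r ≠ t) : f t + f r ≤ 2 := by
    rw [← Finset.sum_pair hr.symm]
    exact hsum {t, r}
  have htwo : f t ≤ 2 := by
    rw [← Finset.sum_singleton f t]
    exact hsum {t}
  refine .inr ?_
  by_cases hone : f t = 2
  · exact .inl ⟨t, hone, fun r hr => by have := hpair hr; omega⟩
  by_cases hrest : ∀ r, r ≠ t → f r = 0
  · exact .inr ⟨t, t + 1, by omega, by omega, by rw [hrest _ (by omega)]; omega,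
      fun r hr _ => hrest r hr⟩
  push Not at hrest
  obtain ⟨s, hst, hs⟩ := hrest
  have hts : t < s := lt_of_le_of_ne (le_of_not_gt fun h => hs (hbefore s h)) hst.symm
  refine .inr ⟨t, s, hts, by omega, by have := hpair hst; omega, fun r hrt hrs => ?_⟩
  have htriple := hsum {t, s, r}
  rw [Finset.sum_insert (by simp [hst.symm, hrt.symm]), Finset.sum_pair hrs.symm] at htriple
  omega

theorem Legal.levelCover_eq_empty (hq : Legal T f q) (ht : f t = 0) : levelCover T q t = ∅ :=
  Finset.card_eq_zero.1 (Nat.le_zero.1 (ht ▸ hq.card_levelCover_le t))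

theorem Legal.apply_ne_zero_of_mem_levelCover (hq : Legal T f q) (hv : v ∈ levelCover T q t) :
    f t ≠ 0 := fun ht => Finset.notMem_empty v (hq.levelCover_eq_empty ht ▸ hv)

theorem Legal.exists_mem_levelCover_of_saved_pos (hq : Legal T f q) (h : 0 < saved T q) :
    ∃ t, ∃ v, v ∈ levelCover T q t := by
  obtain ⟨w, hw⟩ := (Set.ncard_pos (Set.toFinite _)).1 h
  obtain ⟨t, v, hv, -⟩ := hq.exists_mem_levelCover hw
  exact ⟨t, v, hv⟩

theorem Legal.exists_saved_le_weight_add (hq : Legal T f q) (hts : t < s) (ht : f t ≤ 1)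
    (hf : ∀ r, r ≠ t → r ≠ s → f r = 0) (hpos : 0 < saved T q) :
    ∃ u, level T u = t + 1 ∧ saved T q ≤ weight T u + f s * maxWeightOff T u (s + 1) := by
  have hturn : ∀ r v, v ∈ levelCover T q r → r = t ∨ r = s := fun r v hv => by
    by_contra! h
    exact hq.apply_ne_zero_of_mem_levelCover hv (hf r h.1 h.2)
  obtain ⟨u, hu, hcover⟩ : ∃ u, level T u = t + 1 ∧ ∀ v ∈ levelCover T q t, v = u := by
    rcases (levelCover T q t).eq_empty_or_nonempty with hempty | ⟨u, hu⟩
    · obtain ⟨r, v, hv⟩ := hq.exists_mem_levelCover_of_saved_pos hpos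
      have hr := hturn r v hv
      have hl := level_of_mem_levelCover hv
      exact ⟨ancestorAt T (t + 1) v, level_ancestorAt (by omega), by simp [hempty]⟩
    · exact ⟨u, level_of_mem_levelCover hu, fun v hv =>
        Finset.card_le_one.1 ((hq.card_levelCover_le t).trans ht) v hv u hu⟩
  refine ⟨u, hu, ?_⟩
  rw [← Finset.sum_singleton (fun r => f r * maxWeightOff T u (r + 1)) s]
  refine hq.saved_le_weight_add_sum {s} fun r hr v hv => ?_
  obtain rfl : r = t := (hturn r v hv).resolve_right (by simpa using hr)
  exact hcover v hv ▸ .refl v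

theorem Legal.weight_add_maxWeightOff_le_saved (hp : Legal T f p) (hc : level T c ≤ s)
    (hQ : protectedBy T p s = {c}) (hs : f s ≤ 1)
    (hserve : Serve T s (burnt T p s) {c} (f s) (protectedBy T p (s + 1))) :
    weight T c + f s * maxWeightOff T c (s + 1) ≤ saved T p := by
  classical
  have hsaved : ∀ n, ∀ v ∈ protectedBy T p n, v ∈ savedSet T p :=
    fun _ v ⟨_, _, hv⟩ => hp.mem_savedSet hv (.refl v)
  have hcs : c ∈ savedSet T p := hsaved s c (hQ ▸ rfl)
  have hwc : weight T c ≤ saved T p := by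
    simpa using hp.sum_weight_le_saved (S := {c}) (by simpa using hcs) (by simp)
  obtain h0 | h1 : f s = 0 ∨ f s = 1 := by omega
  · simpa [h0] using hwc
  rw [h1, one_mul]
  rw [h1] at hserve
  have hC := hp.children_eq_of_protectedBy_eq_singleton hQ
  rcases serve_succ_iff.1 hserve with ⟨hempty, -⟩ | ⟨z, -, hz, hserve⟩
  · have hoff : maxWeightOff T c (s + 1) ≤ 0 :=
      maxWeightOff_le fun v hcv hv => absurd (hC.superset ⟨hv, hcv⟩) (by simp [hempty])
    omega
  obtain ⟨hzC, hzmax⟩ := hz.2 (Set.singleton_ne_empty c)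
  obtain ⟨hzl, hcz⟩ := hC.subset hzC
  have hzs : z ∈ savedSet T p := hsaved (s + 1) z (serve_zero_iff.1 hserve ▸ by simp)
  have hzc : ¬ AncestorOrEq T z c := fun h => by
    have := h.level_le
    rw [hzl] at this
    omega
  have hoff : maxWeightOff T c (s + 1) ≤ weight T z :=
    maxWeightOff_le fun v hcv hv => hzmax v (hC.superset ⟨hv, hcv⟩)
  calc weight T c + maxWeightOff T c (s + 1) ≤ weight T c + weight T z := by gcongr
    _ = ∑ v ∈ {c, z}, weight T v :=
      (Finset.sum_pair (by rintro rfl; exact hcz (.refl _))).symm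
    _ ≤ saved T p := hp.sum_weight_le_saved (by simp [hcs, hzs])
      (by simpa [IsAntichain, Set.pairwise_pair] using fun _ => ⟨hcz, hzc⟩)

end FewFirefighters

section TwoFirefightersCompetitive

variable {T : RootedTree} {p q : ℕ → Finset T.V} {f : ℕ → ℕ} {s t : ℕ}

theorem saved_le_of_serve_two (hp : Legal T f p) (hq : Legal T f q)
    (hserve : Serve T t (burnt T p t) (protectedBy T p t) 2 (protectedBy T p (t + 1)))
    (ht : f t = 2) (hf : ∀ r, r ≠ t → f r = 0) : saved T q ≤ saved T p := by
  have hQ : protectedBy T p t = ∅ :=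
    (hp.protectedBy_eq t.zero_le fun r _ hr => hf r hr.ne).trans protectedBy_zero
  have hC := hp.children_eq_of_protectedBy_eq_empty hQ
  obtain ⟨Y, hY, hle⟩ := (hQ ▸ hserve).exists_sum_weight_le (X := levelCover T q t)
    (fun v hv => hC ▸ level_of_mem_levelCover hv) (ht ▸ hq.card_levelCover_le t)
  have hlevel : ∀ y ∈ Y, level T y = t + 1 := fun y hy => hC.subset (hY hy).1
  calc saved T q ≤ ∑ r ∈ {t}, ∑ v ∈ levelCover T q r, weight T v := by
        refine ncard_le_sum_weight fun v hv => ?_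
        obtain ⟨r, u, hu, huv⟩ := hq.exists_mem_levelCover hv
        refine ⟨r, Finset.mem_singleton.2 (by_contra fun hr => ?_), u, hu, huv⟩
        exact hq.apply_ne_zero_of_mem_levelCover hu (hf r hr)
    _ ≤ ∑ y ∈ Y, weight T y := by rwa [Finset.sum_singleton]
    _ ≤ saved T p := hp.sum_weight_le_saved
      (fun y hy => by
        obtain ⟨r, -, hr⟩ := (hY hy).2
        exact hp.mem_savedSet hr (.refl y))
      (fun u hu v hv huv h => huv (h.eq_of_level_le (by rw [hlevel u hu, hlevel v hv])))

theorem saved_le_goldenRatio_mul_of_serve_one (hp : Legal T f p) (hq : Legal T f q)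
    (hserve : ∀ n, Serve T n (burnt T p n) (protectedBy T p n) (f n) (protectedBy T p (n + 1)))
    (hts : t < s) (ht : f t = 1) (hs : f s ≤ 1) (hf : ∀ r, r ≠ t → r ≠ s → f r = 0) :
    (saved T q : ℝ) ≤ Real.goldenRatio * saved T p := by
  rcases Nat.eq_zero_or_pos (saved T q) with hzero | hpos
  · rw [hzero, Nat.cast_zero]
    positivity
  obtain ⟨u, hu, hle⟩ := hq.exists_saved_le_weight_add hts ht.le hf hpos
  have hQ : protectedBy T p t = ∅ :=
    (hp.protectedBy_eq t.zero_le fun r _ hr => hf r hr.ne (by omega)).trans protectedBy_zero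
  have hC := hp.children_eq_of_protectedBy_eq_empty hQ
  obtain ⟨c, hc, hQc⟩ : ∃ c, IsFirstPlacement T t c ∧ protectedBy T p (t + 1) = {c} := by
    have hturn := hserve t
    rw [hQ, ht] at hturn
    rcases serve_succ_iff.1 hturn with ⟨hempty, -⟩ | ⟨c, -, hc, hturn⟩
    · exact absurd (hC.superset hu) (by simp [hempty])
    · exact ⟨c, hc.isFirstPlacement hC, (serve_zero_iff.1 hturn).trans (insert_empty_eq c)⟩
  have hQs : protectedBy T p s = {c} :=
    (hp.protectedBy_eq hts fun r hr hrs => hf r (by omega) hrs.ne).trans hQc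
  have hcp : weight T c + f s * maxWeightOff T c (s + 1) ≤ saved T p :=
    hp.weight_add_maxWeightOff_le_saved (by rw [hc.level_eq]; omega) hQs hs (hQs ▸ hserve s)
  calc (saved T q : ℝ) ≤ weight T u + f s * maxWeightOff T u (s + 1) := mod_cast hle
    _ ≤ Real.goldenRatio * (weight T c + f s * maxWeightOff T c (s + 1)) := by
      obtain h0 | h1 : f s = 0 ∨ f s = 1 := by omega
      · simpa [h0] using hc.weight_le hu
      · simpa [h1] using hc.weight_add_maxWeightOff_le hu (by omega)
    _ ≤ Real.goldenRatio * saved T p := by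
      gcongr
      exact_mod_cast hcp

theorem IsTwoFirefighterOn.saved_le_goldenRatio_mul {A : Strategy T}
    (hA : IsTwoFirefighterOn T A) (hf : f ∈ atMost 2) (hq : Legal T f q) :
    (saved T q : ℝ) ≤ Real.goldenRatio * saved T (A.play f) := by
  have hp := A.legal f
  rcases eq_zero_or_of_mem_atMost_two hf with h0 | ⟨t, ht, hrest⟩ | ⟨t, s, hts, ht, hs, hrest⟩
  · have hzero : saved T q = 0 := by
      by_contra h
      obtain ⟨t, v, hv⟩ := hq.exists_mem_levelCover_of_saved_pos (Nat.pos_of_ne_zero h)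
      exact hq.apply_ne_zero_of_mem_levelCover hv (h0 t)
    rw [hzero, Nat.cast_zero]
    positivity
  · have hle : (saved T q : ℝ) ≤ saved T (A.play f) :=
      mod_cast saved_le_of_serve_two hp hq (ht ▸ hA f t) ht hrest
    exact hle.trans (le_mul_of_one_le_left (by positivity) Real.one_lt_goldenRatio.le)
  · exact saved_le_goldenRatio_mul_of_serve_one hp hq (hA f) hts ht hs hrest

theorem IsTwoFirefighterAlgorithm.competitive {A : OnlineAlgorithm}
    (hA : IsTwoFirefighterAlgorithm A) : Competitive A (atMost 2) (1 / Real.goldenRatio) := by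
  have hle : 1 / Real.goldenRatio ≤ 1 :=
    (div_le_one Real.goldenRatio_pos).2 Real.one_lt_goldenRatio.le
  refine ⟨by positivity, hle, fun T f hf => le_ratio hle fun q hq => ?_⟩
  rw [one_div, inv_mul_le_iff₀ Real.goldenRatio_pos]
  exact (hA T).saved_le_goldenRatio_mul hf hq

end TwoFirefightersCompetitive

section Adversary

variable {T : RootedTree} {f : ℕ → ℕ}

theorem exists_legal_sum_weight_le_saved {S : Finset T.V} (hroot : T.root ∉ S)
    (hcard : ∀ t, (S.filter fun v => level T v = t + 1).card ≤ f t)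
    (hanti : IsAntichain (AncestorOrEq T) (S : Set T.V)) :
    ∃ q, Legal T f q ∧ ∑ v ∈ S, weight T v ≤ saved T q := by
  have hq : Legal T f fun t => S.filter fun v => level T v = t + 1 := by
    refine legal_of_level hcard fun t v hv => ?_
    have hl := (Finset.mem_filter.1 hv).2
    refine ⟨by omega, ?_⟩
    rintro ⟨s, hs, hvs⟩
    have hls := (Finset.mem_filter.1 hvs).2
    omega
  refine ⟨_, hq, hq.sum_weight_le_saved (fun v hv => ?_) hanti⟩
  obtain ⟨t, ht⟩ := Nat.exists_eq_succ_of_ne_zero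
    fun h => hroot (level_eq_zero_iff.1 h ▸ hv : T.root ∈ S)
  exact hq.mem_savedSet (Finset.mem_filter.2 ⟨hv, ht⟩) (.refl v)

/-- The sequence with which the adversary tests an algorithm on the trees `W k l m`: one
firefighter in the first turn, `a` in the second, `b` in the third and none afterwards. -/
def arrivals (a b : ℕ) : ℕ → ℕ
  | 0 => 1
  | 1 => a
  | 2 => b
  | _ + 3 => 0

theorem arrivals_mem_atMost {a b k : ℕ} (h : 1 + a + b ≤ k) : arrivals a b ∈ atMost k := by
  intro n
  calc ∑ t ∈ Finset.range n, arrivals a b t ≤ ∑ t ∈ Finset.range (n + 3), arrivals a b t :=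
        Finset.sum_le_sum_of_subset (Finset.range_mono (Nat.le_add_right n 3))
    _ = 1 + a + b := by
      simp only [Finset.sum_range_succ', arrivals, Finset.sum_const_zero]
      omega
    _ ≤ k := h

end Adversary

section LevelW

open WVertex

variable {k l m : ℕ} {u v : WVertex k l m}

theorem WVertex.depth_eq_depth_parent_add_one (hv : v ≠ .r) : v.depth = v.parent.depth + 1 := by
  match v with
  | r => exact absurd rfl hv
  | x => rfl
  | center => rfl
  | leaf _ => rfl
  | y => rfl
  | chain _ ⟨0, _⟩ => rfl
  | chain i ⟨j + 1, h⟩ => rfl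

theorem W_adj_parent (hv : v ≠ .r) : (W k l m).graph.Adj v.parent v := by
  refine (SimpleGraph.fromRel_adj _ _ _).2 ⟨fun h => ?_, .inr rfl⟩
  exact (v.depth_parent hv).ne (congrArg depth h)

theorem depth_le_depth_add_one_of_W_adj (h : (W k l m).graph.Adj u v) :
    v.depth ≤ u.depth + 1 := by
  obtain ⟨hne, hpar⟩ := (SimpleGraph.fromRel_adj _ _ _).1 h
  rcases hpar with rfl | rfl
  · have hlt := u.depth_parent (by rintro rfl; exact hne rfl)
    omega
  · exact (depth_eq_depth_parent_add_one (by rintro rfl; exact hne rfl)).le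

theorem level_W_le_depth (v : WVertex k l m) : level (W k l m) v ≤ v.depth := by
  induction hn : v.depth using Nat.strong_induction_on generalizing v with
  | _ n ih =>
    by_cases hv : v = .r
    · subst hv
      exact level_root.le.trans n.zero_le
    · have hdepth := depth_eq_depth_parent_add_one hv
      have hle := ih v.parent.depth (by omega) v.parent rfl
      have hadj := level_eq_of_adj (W_adj_parent hv)
      omega

theorem depth_le_level_W (v : WVertex k l m) : v.depth ≤ level (W k l m) v := by
  induction hn : level (W k l m) v generalizing v with
  | zero =>
    obtain rfl : v = .r := level_eq_zero_iff.1 hn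
    exact le_rfl
  | succ n ih =>
    obtain ⟨w, hwv, hw⟩ := exists_parent hn
    exact (depth_le_depth_add_one_of_W_adj hwv).trans (Nat.succ_le_succ (ih w hw))

theorem level_W (v : WVertex k l m) : level (W k l m) v = v.depth :=
  (level_W_le_depth v).antisymm (depth_le_level_W v)

end LevelW

section WeightW

open WVertex

variable {k l m : ℕ} {u v : WVertex k l m}

/-- The relation `AncestorOrEq (W k l m)`, read on the labels `WVertex k l m` instead of on
`(W k l m).V`, which unfolds to the same type only at default transparency. -/
def WVertex.IsAncestor (u v : WVertex k l m) : Prop :=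
  AncestorOrEq (W k l m) u v

theorem isAncestor_iff_parent (hv : v ≠ .r) : IsAncestor u v ↔ u = v ∨ IsAncestor u v.parent :=
  ancestorOrEq_iff_of_adj (W_adj_parent hv)
    (by rw [level_W, level_W, depth_eq_depth_parent_add_one hv])

theorem isAncestor_r_iff : IsAncestor u r ↔ u = r :=
  ⟨fun h => AncestorOrEq.eq_of_level_le h (level_root.le.trans (Nat.zero_le _)),
    fun h => h ▸ AncestorOrEq.refl _⟩

theorem isAncestor_x_iff : IsAncestor u x ↔ u = x ∨ u = r :=
  (isAncestor_iff_parent (by simp)).trans (or_congr_right isAncestor_r_iff)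

theorem isAncestor_center_iff : IsAncestor u center ↔ u = center ∨ u = x ∨ u = r :=
  (isAncestor_iff_parent (by simp)).trans (or_congr_right isAncestor_x_iff)

theorem isAncestor_leaf_iff {i : Fin (l - 2)} :
    IsAncestor u (leaf i) ↔ u = leaf i ∨ u = center ∨ u = x ∨ u = r :=
  (isAncestor_iff_parent (by simp)).trans (or_congr_right isAncestor_center_iff)

theorem isAncestor_y_iff : IsAncestor u y ↔ u = y ∨ u = r :=
  (isAncestor_iff_parent (by simp)).trans (or_congr_right isAncestor_r_iff)

theorem isAncestor_chain_iff {i : Fin k} {j : Fin ((m - 1) / k)} :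
    IsAncestor u (chain i j) ↔ (∃ a ≤ j, u = chain i a) ∨ u = y ∨ u = r := by
  obtain ⟨j, hj⟩ := j
  induction j with
  | zero =>
    rw [isAncestor_iff_parent (by simp), parent, isAncestor_y_iff]
    refine or_congr_left ⟨fun h => ⟨_, le_rfl, h⟩, ?_⟩
    rintro ⟨a, ha, rfl⟩
    exact congrArg (chain i) (Fin.ext (Nat.le_zero.1 ha))
  | succ j ih =>
    rw [isAncestor_iff_parent (by simp), parent, ih, ← or_assoc]
    refine or_congr_left ?_
    simp only [Fin.le_def, Fin.exists_iff, Nat.le_succ_iff]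
    grind

/-- The weight of a vertex of `W k l m`, as a function on `WVertex k l m` for the same reason. -/
protected def WVertex.weight (u : WVertex k l m) : ℕ :=
  Firefighter.weight (W k l m) u

theorem ncard_setOf_isAncestor (u : WVertex k l m) :
    {v : WVertex k l m | IsAncestor u v}.ncard = u.weight :=
  rfl

theorem setOf_isAncestor_leaf (i : Fin (l - 2)) :
    {v : WVertex k l m | IsAncestor (leaf i) v} = {leaf i} := by
  ext v
  cases v <;> simp [isAncestor_r_iff, isAncestor_x_iff, isAncestor_center_iff,
    isAncestor_leaf_iff, isAncestor_y_iff, isAncestor_chain_iff, eq_comm]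

theorem setOf_isAncestor_center :
    {v : WVertex k l m | IsAncestor center v} = insert center (Set.range leaf) := by
  ext v
  cases v <;> simp [isAncestor_r_iff, isAncestor_x_iff, isAncestor_center_iff,
    isAncestor_leaf_iff, isAncestor_y_iff, isAncestor_chain_iff]

theorem setOf_isAncestor_x :
    {v : WVertex k l m | IsAncestor x v} = insert x {v | IsAncestor center v} := by
  ext v
  cases v <;> simp [isAncestor_r_iff, isAncestor_x_iff, isAncestor_center_iff,
    isAncestor_leaf_iff, isAncestor_y_iff, isAncestor_chain_iff]

theorem setOf_isAncestor_y : {v : WVertex k l m | IsAncestor y v} =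
    insert y (Set.range fun ij : Fin k × Fin ((m - 1) / k) => chain ij.1 ij.2) := by
  ext v
  cases v <;> simp [isAncestor_r_iff, isAncestor_x_iff, isAncestor_center_iff,
    isAncestor_leaf_iff, isAncestor_y_iff, isAncestor_chain_iff]

theorem setOf_isAncestor_chain (i : Fin k) (j : Fin ((m - 1) / k)) :
    {v : WVertex k l m | IsAncestor (chain i j) v} = chain i '' Set.Ici j := by
  ext v
  cases v <;> simp [isAncestor_r_iff, isAncestor_x_iff, isAncestor_center_iff,
    isAncestor_leaf_iff, isAncestor_y_iff, isAncestor_chain_iff]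

theorem weight_leaf (i : Fin (l - 2)) : (leaf i : WVertex k l m).weight = 1 := by
  rw [← ncard_setOf_isAncestor, setOf_isAncestor_leaf, Set.ncard_singleton]

theorem weight_center (hl : 2 ≤ l) : (center : WVertex k l m).weight = l - 1 := by
  have hinj : Function.Injective (leaf : Fin (l - 2) → WVertex k l m) :=
    fun i j h => leaf.inj h
  rw [← ncard_setOf_isAncestor, setOf_isAncestor_center,
    Set.ncard_insert_of_notMem (by simp) (Set.toFinite _), Set.ncard_range_of_injective hinj,
    Nat.card_fin]
  omega

theorem weight_x (hl : 2 ≤ l) : (x : WVertex k l m).weight = l := by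
  have hx : (x : WVertex k l m) ∉ {v | IsAncestor center v} := by simp [isAncestor_x_iff]
  rw [← ncard_setOf_isAncestor, setOf_isAncestor_x,
    Set.ncard_insert_of_notMem hx (Set.toFinite _), ncard_setOf_isAncestor, weight_center hl]
  omega

theorem weight_y (hm : 1 ≤ m) (hkm : k ∣ m - 1) : (y : WVertex k l m).weight = m := by
  have hinj : Function.Injective
      fun ij : Fin k × Fin ((m - 1) / k) => (chain ij.1 ij.2 : WVertex k l m) :=
    fun a b h => Prod.ext (chain.inj h).1 (chain.inj h).2
  rw [← ncard_setOf_isAncestor, setOf_isAncestor_y,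
    Set.ncard_insert_of_notMem (by simp) (Set.toFinite _), Set.ncard_range_of_injective hinj,
    Nat.card_prod, Nat.card_fin, Nat.card_fin, Nat.mul_div_cancel' hkm]
  omega

theorem weight_chain (i : Fin k) (j : Fin ((m - 1) / k)) :
    (chain i j : WVertex k l m).weight = (m - 1) / k - j := by
  have hinj : Function.Injective (chain i : Fin ((m - 1) / k) → WVertex k l m) :=
    fun a b h => (chain.inj h).2
  rw [← ncard_setOf_isAncestor, setOf_isAncestor_chain, Set.ncard_image_of_injective _ hinj,
    ← Finset.coe_Ici, Set.ncard_coe_finset, Fin.card_Ici]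

theorem maxWeightOff_x_two_le : maxWeightOff (W k l m) x 2 ≤ (m - 1) / k := by
  refine maxWeightOff_le fun (v : WVertex k l m) hxv hv => ?_
  rw [level_W] at hv
  cases v with
  | center => exact absurd (isAncestor_center_iff.2 (by simp)) hxv
  | chain i j => exact (weight_chain i j).le.trans (Nat.sub_le _ _)
  | _ => simp [depth] at hv

theorem maxWeightOff_y_three_le : maxWeightOff (W k l m) y 3 ≤ 1 := by
  refine maxWeightOff_le fun (v : WVertex k l m) hyv hv => ?_
  rw [level_W] at hv
  cases v with
  | leaf i => exact (weight_leaf i).le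
  | chain i j => exact absurd (isAncestor_chain_iff.2 (by simp)) hyv
  | _ => simp [depth] at hv

end WeightW

section PlaysOnW

open WVertex

variable {k l m a b : ℕ} {f : ℕ → ℕ}

theorem exists_legal_W {S : Finset (WVertex k l m)} (hr : r ∉ S)
    (hcard : ∀ t, (S.filter fun v => v.depth = t + 1).card ≤ f t)
    (hanti : IsAntichain IsAncestor (S : Set (WVertex k l m))) :
    ∃ q, Legal (W k l m) f q ∧ ∑ v ∈ S, v.weight ≤ saved (W k l m) q :=
  exists_legal_sum_weight_le_saved (T := W k l m) hr
    (fun t => by rw [funext level_W]; exact hcard t) hanti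

theorem exists_legal_arrivals_le_saved_of_y (hm : 1 ≤ m) (hkm : k ∣ m - 1) :
    ∃ q, Legal (W k l m) (arrivals 0 0) q ∧ m ≤ saved (W k l m) q := by
  have hcard : ∀ t, (({y} : Finset (WVertex k l m)).filter fun v => v.depth = t + 1).card
      ≤ arrivals 0 0 t := by
    rintro (_ | t)
    · exact Finset.card_filter_le _ _
    · rw [Finset.filter_singleton]
      simp [depth]
  obtain ⟨q, hq, hle⟩ := exists_legal_W (by simp) hcard (by simp)
  rw [Finset.sum_singleton, weight_y hm hkm] at hle
  exact ⟨q, hq, hle⟩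

theorem exists_legal_arrivals_le_saved_of_y_center (hl : 2 ≤ l) (hm : 1 ≤ m) (hkm : k ∣ m - 1) :
    ∃ q, Legal (W k l m) (arrivals 1 0) q ∧ m + (l - 1) ≤ saved (W k l m) q := by
  have hcard : ∀ t, (({y, center} : Finset (WVertex k l m)).filter fun v => v.depth = t + 1).card
      ≤ arrivals 1 0 t := by
    rintro (_ | _ | t) <;> rw [Finset.filter_insert, Finset.filter_singleton] <;>
      simp [depth, arrivals]
  obtain ⟨q, hq, hle⟩ := exists_legal_W (by simp) hcard
    (by simp [isAntichain_insert, isAncestor_y_iff, isAncestor_center_iff])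
  rw [Finset.sum_pair (by simp), weight_y hm hkm, weight_center hl] at hle
  exact ⟨q, hq, hle⟩

theorem exists_legal_arrivals_le_saved_of_x (hl : 2 ≤ l) (hb : b ≤ k) (hn : 2 ≤ (m - 1) / k) :
    ∃ q, Legal (W k l m) (arrivals 0 b) q ∧ l + b * ((m - 1) / k - 1) ≤ saved (W k l m) q := by
  obtain ⟨J, hJ⟩ : ∃ J : Finset (Fin k), J.card = b := by
    simpa using Finset.exists_subset_card_eq (s := Finset.univ) (by simpa using hb)
  let S := J.image fun i => (chain i ⟨1, hn⟩ : WVertex k l m)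
  have hS : ∑ v ∈ S, v.weight = b * ((m - 1) / k - 1) := by
    rw [Finset.sum_image fun i _ j _ h => (chain.inj h).1]
    simp [weight_chain, hJ]
  have hdepth : ∀ v ∈ S, v.depth = 3 := by simp [S, depth]
  have hcard : ∀ t, ((insert x S).filter fun v => v.depth = t + 1).card ≤ arrivals 0 b t := by
    intro t
    rw [Finset.filter_insert, Finset.filter_congr fun v hv => by rw [hdepth v hv]]
    rcases t with _ | _ | _ | t
    case succ.succ.zero => simpa [depth, arrivals] using Finset.card_image_le.trans hJ.le
    all_goals simp [depth, arrivals]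
  have hanti : IsAntichain IsAncestor (insert x S : Set (WVertex k l m)) := by
    refine isAntichain_insert.2 ⟨fun v hv w hw hne hvw => hne ?_, ?_⟩
    · exact AncestorOrEq.eq_of_level_le hvw
        (by rw [level_W, level_W, hdepth v hv, hdepth w hw])
    · simp [S, isAncestor_x_iff, isAncestor_chain_iff]
  obtain ⟨q, hq, hle⟩ := exists_legal_W (by simp [S]) hcard (by simpa using hanti)
  rw [Finset.sum_insert (by simp [S]), weight_x hl, hS] at hle
  exact ⟨q, hq, hle⟩

theorem levelCover_zero_eq_x_or_eq_y {p : ℕ → Finset (W k l m).V} (hp : Legal (W k l m) f p)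
    (hf : f 0 ≤ 1) :
    (∀ v ∈ levelCover (W k l m) p 0, v = x) ∨ ∀ v ∈ levelCover (W k l m) p 0, v = y := by
  have hxy : ∀ v : WVertex k l m, v ∈ levelCover (W k l m) p 0 → v = x ∨ v = y := by
    intro v hv
    have hdepth := (level_W v).symm.trans (level_of_mem_levelCover hv)
    cases v <;> simp [depth] at hdepth ⊢
  have hcard := Finset.card_le_one.1 ((hp.card_levelCover_le 0).trans hf)
  by_cases hx : x ∈ levelCover (W k l m) p 0
  · exact .inl fun v hv => hcard v hv x hx
  · exact .inr fun v hv => (hxy v hv).resolve_left fun h => hx (h ▸ hv)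

theorem Legal.saved_le_of_levelCover_eq_x {p : ℕ → Finset (W k l m).V} (hl : 2 ≤ l)
    (hp : Legal (W k l m) (arrivals a 0) p) (hx : ∀ v ∈ levelCover (W k l m) p 0, v = x) :
    saved (W k l m) p ≤ l + a * ((m - 1) / k) := by
  refine (hp.saved_le_weight_add_sum {1} (u := (x : WVertex k l m)) ?_).trans ?_
  · rintro (_ | _ | t) ht v hv
    · exact hx v hv ▸ .refl _
    · exact absurd (Finset.mem_singleton_self 1) ht
    · exact absurd (by cases t <;> rfl) (hp.apply_ne_zero_of_mem_levelCover hv)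
  · rw [Finset.sum_singleton]
    exact Nat.add_le_add (weight_x hl).le (Nat.mul_le_mul_left a maxWeightOff_x_two_le)

theorem Legal.saved_le_of_levelCover_eq_y {p : ℕ → Finset (W k l m).V} (hm : 1 ≤ m)
    (hkm : k ∣ m - 1) (hp : Legal (W k l m) (arrivals 0 b) p)
    (hy : ∀ v ∈ levelCover (W k l m) p 0, v = y) : saved (W k l m) p ≤ m + b := by
  refine (hp.saved_le_weight_add_sum {2} (u := (y : WVertex k l m)) ?_).trans ?_
  · rintro (_ | _ | _ | t) ht v hv
    · exact hy v hv ▸ .refl _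
    · exact absurd rfl (hp.apply_ne_zero_of_mem_levelCover hv)
    · exact absurd (Finset.mem_singleton_self 2) ht
    · exact absurd rfl (hp.apply_ne_zero_of_mem_levelCover hv)
  · rw [Finset.sum_singleton]
    exact Nat.add_le_add (weight_y hm hkm).le
      ((Nat.mul_le_mul_left b maxWeightOff_y_three_le).trans_eq (mul_one b))

theorem treeValue_W_le {K : ℕ} {c : ℝ} (hl : 2 ≤ l) (hkm : k ∣ m - 1) (hn : 2 ≤ (m - 1) / k)
    (ha : a ≤ 1) (hb : b ≤ k) (haK : 1 + a ≤ K) (hbK : 1 + b ≤ K)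
    (hx : ((l + a * ((m - 1) / k) : ℕ) : ℝ) / (m + a * (l - 1) : ℕ) ≤ c)
    (hy : ((m + b : ℕ) : ℝ) / (l + b * ((m - 1) / k - 1) : ℕ) ≤ c) :
    treeValue K (W k l m) ≤ c := by
  have hm : 1 ≤ m := by
    by_contra h
    simp [Nat.lt_one_iff.1 (not_le.1 h)] at hn
  refine treeValue_le fun A => ?_
  -- By causality the first move is the same for all the sequences `arrivals a b`.
  have hfirst : ∀ a' b', A.play (arrivals a' b') 0 = A.play (arrivals 0 0) 0 := fun a' b' =>
    A.causal _ _ 0 fun s hs => by rw [Nat.le_zero.1 hs]; rfl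
  have hcover : ∀ a' b', levelCover (W k l m) (A.play (arrivals a' b')) 0 =
      levelCover (W k l m) (A.play (arrivals 0 0)) 0 := fun a' b' => by
    rw [levelCover, levelCover, hfirst]
  rcases levelCover_zero_eq_x_or_eq_y (A.legal (arrivals 0 0)) le_rfl with h | h
  · obtain ⟨q, hq, hqs⟩ : ∃ q, Legal (W k l m) (arrivals a 0) q ∧
        m + a * (l - 1) ≤ saved (W k l m) q := by
      interval_cases a
      · simpa using exists_legal_arrivals_le_saved_of_y hm hkm
      · simpa using exists_legal_arrivals_le_saved_of_y_center hl hm hkm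
    exact ⟨_, arrivals_mem_atMost haK, (ratio_le_div hq
      ((A.legal _).saved_le_of_levelCover_eq_x hl (hcover a 0 ▸ h)) hqs (by omega)).trans hx⟩
  · obtain ⟨q, hq, hqs⟩ := exists_legal_arrivals_le_saved_of_x hl hb hn
    exact ⟨_, arrivals_mem_atMost (by omega), (ratio_le_div hq
      ((A.legal _).saved_le_of_levelCover_eq_y hm hkm (hcover 0 b ▸ h)) hqs
      (by omega)).trans hy⟩

end PlaysOnW

theorem half_le_alpha (k : ℕ) : 1 / 2 ≤ alpha k := by
  obtain ⟨A, hA⟩ := exists_isGreedy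
  exact (hA.competitive (atMost k)).le_alpha subset_rfl

theorem alpha_succ_le {k : ℕ} (hk : 2 ≤ k) : alpha (k + 1) ≤ 1 / 2 + 2 / k := by
  have hk' : (2 : ℝ) ≤ k := mod_cast hk
  have hdiv : (k ^ 2 + 1 - 1) / k = k := by
    rw [Nat.add_sub_cancel, pow_two, Nat.mul_div_cancel _ (by omega)]
  have hdvd : k ∣ k ^ 2 + 1 - 1 := dvd_pow_self k two_ne_zero
  refine (alpha_le_treeValue _ (W k (k ^ 2 + 1) (k ^ 2 + 1))).trans
    (treeValue_W_le (a := 1) (b := k) (by nlinarith) hdvd (by omega) le_rfl le_rfl (by omega)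
      (by omega) ?_ ?_)
  · rw [hdiv, Nat.add_sub_cancel]
    push_cast
    rw [div_add_div _ _ two_ne_zero (by positivity),
      div_le_div_iff₀ (by positivity) (by positivity)]
    nlinarith
  · rw [hdiv]
    push_cast [Nat.cast_sub (show 1 ≤ k by omega)]
    rw [div_add_div _ _ two_ne_zero (by positivity),
      div_le_div_iff₀ (by nlinarith) (by positivity)]
    nlinarith

theorem tendsto_alpha : Tendsto alpha atTop (𝓝 (1 / 2)) := by
  have hbound : Tendsto (fun k : ℕ => (1 / 2 : ℝ) + 2 / k) atTop (𝓝 (1 / 2)) := by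
    simpa only [add_zero] using
      (tendsto_const_div_atTop_nhds_zero_nat (2 : ℝ)).const_add (1 / 2 : ℝ)
  rw [← tendsto_add_atTop_iff_nat 1]
  refine tendsto_of_tendsto_of_tendsto_of_le_of_le' tendsto_const_nhds hbound
    (Eventually.of_forall fun k => half_le_alpha _) ?_
  filter_upwards [eventually_ge_atTop 2] with k hk using alpha_succ_le hk

theorem alpha_two_le_max_fib {n : ℕ} (hn : 5 ≤ n) :
    alpha 2 ≤ max ((Nat.fib n : ℝ) / Nat.fib (n + 1))
      ((Nat.fib (n + 1) + 1 : ℝ) / (Nat.fib (n + 2) - 2)) := by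
  have hl : n ≤ Nat.fib n := Nat.le_fib_self hn
  have hm : n + 1 ≤ Nat.fib (n + 1) := Nat.le_fib_self (by omega)
  have hfib : Nat.fib n + 1 * ((Nat.fib (n + 1) - 1) / 1 - 1) + 2 = Nat.fib (n + 2) := by
    rw [Nat.fib_add_two, Nat.div_one]
    omega
  refine (alpha_le_treeValue _ (W 1 (Nat.fib n) (Nat.fib (n + 1)))).trans
    (treeValue_W_le (a := 0) (b := 1) (by omega) (one_dvd _) (by rw [Nat.div_one]; omega)
      zero_le_one le_rfl one_le_two le_rfl (le_max_of_le_left ?_) (le_max_of_le_right ?_))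
  · simp only [zero_mul, add_zero, le_refl]
  · rw [← hfib]
    push_cast
    rw [add_sub_cancel_right]

theorem tendsto_fib_div_fib_succ :
    Tendsto (fun n => (Nat.fib n : ℝ) / Nat.fib (n + 1)) atTop (𝓝 (1 / Real.goldenRatio)) := by
  rw [one_div, Real.inv_goldenRatio]
  exact tendsto_fib_div_fib_succ_atTop

theorem tendsto_fib_succ_add_one_div_fib_sub_two :
    Tendsto (fun n => (Nat.fib (n + 1) + 1 : ℝ) / (Nat.fib (n + 2) - 2)) atTop
      (𝓝 (1 / Real.goldenRatio)) := by
  have hF : Tendsto (fun n => (Nat.fib (n + 2) : ℝ)) atTop atTop :=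
    tendsto_natCast_atTop_atTop.comp Nat.fib_add_two_strictMono.tendsto_atTop
  have hlim := (((tendsto_add_atTop_iff_nat 1).2 tendsto_fib_div_fib_succ).add
    (hF.const_div_atTop 1)).div ((hF.const_div_atTop 2).const_sub 1) (by norm_num)
  rw [add_zero, sub_zero, div_one] at hlim
  refine hlim.congr fun n => ?_
  have hpos : (Nat.fib (n + 2) : ℝ) ≠ 0 := mod_cast (Nat.fib_pos.2 (by omega)).ne'
  simp only [Pi.div_apply]
  rw [← add_div, one_sub_div hpos, div_div_div_cancel_right₀ hpos]

theorem alpha_two_le : alpha 2 ≤ 1 / Real.goldenRatio := by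
  have hmax := tendsto_fib_div_fib_succ.max tendsto_fib_succ_add_one_div_fib_sub_two
  rw [max_self] at hmax
  refine ge_of_tendsto hmax ?_
  filter_upwards [eventually_ge_atTop 5] with n hn using alpha_two_le_max_fib hn

theorem alpha_two : alpha 2 = 1 / Real.goldenRatio := by
  obtain ⟨A, hA⟩ := exists_isTwoFirefighterAlgorithm
  exact le_antisymm alpha_two_le (hA.competitive.le_alpha subset_rfl)

theorem goldenRatio_lt_d2 : Real.goldenRatio < 1.62 := by
  have hsqrt : √5 < 2.24 := (Real.sqrt_lt' (by norm_num)).2 (by norm_num)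
  rw [Real.goldenRatio]
  linarith

theorem treeValue_four_W_lt : treeValue 4 (W 4 901 1001) < 1 / Real.goldenRatio := by
  calc treeValue 4 (W 4 901 1001) ≤ 1 / 1.62 :=
        treeValue_W_le (a := 1) (b := 3) (by norm_num) (by norm_num) (by norm_num) (by norm_num)
          (by norm_num) (by norm_num) (by norm_num) (by norm_num) (by norm_num)
    _ < 1 / Real.goldenRatio :=
        one_div_lt_one_div_of_lt Real.goldenRatio_pos goldenRatio_lt_d2

end

end Firefighter

theorem mainTheorem3 :
    (∀ k : ℕ, 2 ≤ k → 1 / 2 ≤ Firefighter.alpha k ∧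
      Firefighter.alpha k ≤ 1 / Real.goldenRatio) ∧
    (Tendsto Firefighter.alpha atTop (𝓝 (1 / 2)) ∧
      (∃ A, Firefighter.IsGreedy A) ∧
      ∀ A, Firefighter.IsGreedy A → Firefighter.OptimalWithRatio A Set.univ (1 / 2)) ∧
    (Firefighter.alpha 2 = 1 / Real.goldenRatio ∧
      (∃ A, Firefighter.IsTwoFirefighterAlgorithm A) ∧
      ∀ A, Firefighter.IsTwoFirefighterAlgorithm A →
        Firefighter.OptimalWithRatio A (Firefighter.atMost 2) (1 / Real.goldenRatio)) ∧
    (Firefighter.treeValue 4 (Firefighter.W 4 901 1001) < 1 / Real.goldenRatio ∧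
      Firefighter.alpha 4 < 1 / Real.goldenRatio) := by
  refine ⟨fun k hk => ⟨Firefighter.half_le_alpha k, ?_⟩,
    ⟨Firefighter.tendsto_alpha, Firefighter.exists_isGreedy, fun A hA => ⟨hA.competitive _, ?_⟩⟩,
    ⟨Firefighter.alpha_two, Firefighter.exists_isTwoFirefighterAlgorithm,
      fun A hA => ⟨hA.competitive, ?_⟩⟩,
    Firefighter.treeValue_four_W_lt,
    (Firefighter.alpha_le_treeValue _ _).trans_lt Firefighter.treeValue_four_W_lt⟩
  · exact (Firefighter.alpha_anti hk).trans Firefighter.alpha_two_le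
  · intro B γ hB
    exact ge_of_tendsto' Firefighter.tendsto_alpha fun k => hB.le_alpha (Set.subset_univ _)
  · intro B γ hB
    exact (hB.le_alpha subset_rfl).trans Firefighter.alpha_two_le
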